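/- Let $K$ be a number field of degree $d=[K:\mathbb Q]$ with set of places $M_K$. For $v\in M_K$ let $|\cdot|_v$ be the absolute value extending a standard absolute value of $\mathbb Q$ (so $|p|_v=p^{-1}$ if $v\mid p$, and $|\cdot|_v$ extends the usual absolute value if $v\mid\infty$), and let $d_v=[K_v:\mathbb Q_v]$. For $x\in K$ put $h_v(x)=-\frac{d_v}{d}\min\{\log|x|_v,0\}$, with $h_v(0)=+\infty$. For a finite set $T\subset M_K$ put $h_T(x)=\sum_{v\in T}h_v(x)$ and $\operatorname{lgcd}_T(x,x')=\sum_{v\in T}\min\{h_v(x),h_v(x')\}$. For a nonzero polynomial $F\in K[X,Y]$ let $h_p(F)=\frac1d\sum_{v\in M_K}d_v\log\max_c|c|_v$, where $c$ runs over the nonzero coefficients of $F$. **Proposition.** Let $F(X,Y)\in K[X,Y]$ be absolutely irreducible, $m=\deg_XF$, $n=\deg_YF$. Let $\alpha,\beta\in K$, not both $0$, satisfy $F(\alpha,\beta)=0$. Let $e\ge1$ be an integer, and fix an $e$-th root $\alpha^{1/e}$ of $\alpha$, assumed to lie in $K$. Let $y(x)=\sum_{k\ge1}a_kx^{k/e}\in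 K[[x^{1/e}]]$ be a nonzero series with $F(x,y(x))=0$, and let $\kappa>0$ be the smallest $k$ with $a_k\ne0$, so that $\nu_x(y)=\kappa/e$. Let $T$ be the set of all $v\in M_K$ such that $|\alpha|_v<1$ and the series $y(x)$ converges $v$-adically to $\beta$ at $\alpha$, i.e. $\sum_{k\ge 1} a_k(\alpha^{1/e})^k$ converges to $\beta$ with respect to $|\cdot|_v$. Then $T$ is finite and $$\left|\operatorname{lgcd}_T(\alpha,\beta)-\min\{\kappa/e,1\}\,h_T(\alpha)\right|\le 30n\kappa\,h_p(F)+30n\kappa\log(nm)+15en.$$ -/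

import Mathlib

namespace LocalGcd

/-- The set `M_K` of places of a number field `K`: the finite and the infinite ones. -/
abbrev Place (K : Type*) [Field K] [NumberField K] : Type _ :=
  NumberField.FinitePlace K ⊕ NumberField.InfinitePlace K

/-- `normAbs v x` is `|x|_v ^ d_v`, where `|·|_v` is the absolute value of the place `v` that
extends a standard absolute value of `ℚ`, and `d_v = [K_v : ℚ_v]`. For a finite place this is
Mathlib's absolute value `N(𝔭) ^ (-ord_𝔭 x)`; for an infinite place it is the usual absolute value
to the power `1` (real place) or `2` (complex place). -/
noncomputable def normAbs {K : Type*} [Field K] [NumberField K] : Place K → K → ℝ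
  | Sum.inl v, x => v x
  | Sum.inr v, x => v x ^ v.mult

open Classical in
/-- The local height `h_v(x) = -(d_v / d) * min (log |x|_v) 0`, where `d = [K : ℚ]`;
it is `+∞` at `x = 0`, where `log |x|_v = -∞`. -/
noncomputable def localHeight {K : Type*} [Field K] [NumberField K] (v : Place K) (x : K) :
    ENNReal :=
  if x = 0 then ⊤
  else ENNReal.ofReal (-(min (Real.log (normAbs v x)) 0) / (Module.finrank ℚ K : ℝ))

/-- The `T`-height `h_T(x) = ∑_{v ∈ T} h_v(x)`, for a finite set `T` of places and `x ≠ 0`. -/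
noncomputable def heightOn {K : Type*} [Field K] [NumberField K] (T : Set (Place K)) (x : K) : ℝ :=
  ∑ᶠ v ∈ T, (localHeight v x).toReal

/-- The `T`-local logarithmic gcd `lgcd_T(x, y) = ∑_{v ∈ T} min (h_v(x)) (h_v(y))`, for a finite
set `T` of places and `x`, `y` not both zero. -/
noncomputable def lgcdOn {K : Type*} [Field K] [NumberField K] (T : Set (Place K)) (x y : K) : ℝ :=
  ∑ᶠ v ∈ T, (min (localHeight v x) (localHeight v y)).toReal

/-- The (absolute logarithmic) projective height `h_p(F)` of a polynomial in two variables: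
`(1 / d) * ∑_v d_v * log (max |c|_v)`, the maximum being over the nonzero coefficients `c` of `F`.
Mathlib's `Height.logHeight` is the same sum without the factor `1 / d`. -/
noncomputable def projHeight {K : Type*} [Field K] [NumberField K]
    (F : MvPolynomial (Fin 2) K) : ℝ :=
  Height.logHeight (fun s : F.support => F.coeff s.1) / (Module.finrank ℚ K : ℝ)

/-- A polynomial over `K` is absolutely irreducible if it is irreducible over an algebraic closure
of `K`. -/
def AbsolutelyIrreducible {K : Type*} [Field K] (F : MvPolynomial (Fin 2) K) : Prop :=
  Irreducible (MvPolynomial.map (algebraMap K (AlgebraicClosure K)) F)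

/-- The series `∑ a_k t ^ k` converges `v`-adically to `b` at `t = ξ`. -/
def ConvergesAt {K : Type*} [Field K] [NumberField K] (v : Place K) (a : PowerSeries K)
    (ξ b : K) : Prop :=
  Filter.Tendsto
    (fun N : ℕ => normAbs v ((∑ k ∈ Finset.range N, PowerSeries.coeff k a * ξ ^ k) - b))
    Filter.atTop (nhds 0)

/-- The set `T` of places `v` with `|α|_v < 1` at which the series converges to `β` at `α`. The
series `y(x) = ∑ a_k x ^ (k / e)` is represented by `y(t ^ e) = ∑ a_k t ^ k`, and its convergence
at `α` is that of `y(t ^ e)` at the fixed `e`-th root `ξ` of `α`. -/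
def convSet {K : Type*} [Field K] [NumberField K] (y : PowerSeries K) (α ξ β : K) :
    Set (Place K) :=
  {v | normAbs v α < 1 ∧ ConvergesAt v y ξ β}

end LocalGcd

open Filter Topology

namespace LocalGcd

/-! ### Newton polygon of the equation over the power series ring. -/

section Algebra

variable {K : Type*} [Field K]

/-! Write F = ∑ f_j(X) Y^j, let c_j be the trailing coefficient of f_j, and for v ∈ T let H be the
largest |coefficient of F|_v and S the sum of log(H/|c_j|_v) over the nonzero f_j. If -log|α|_v is
at most S (plus a constant when v is archimedean), the local estimate is trivial, since both terms
compared lie in [0, h_v(α)]. Otherwise α is so close to 0 that the leading term of y governs its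
sum: |β|_v is |a_κ|_v |ξ|_v^κ, exactly or up to a bounded factor. Moreover a_κ is a root of an edge
polynomial of the Newton polygon, whose coefficients are among the c_j (`exists_edge_sum_eq_zero`),
so Cauchy's root bounds control log|a_κ|_v by S (`abs_log_leadingCoeff_le`).

Nonarchimedean v (`apply_eq_of_isNonarchimedean`): y divides f_0 among the series converging at ξ.
The trailing term of f_0 strictly dominates there, and by a Gauss norm argument this passes to the
factor y.

Archimedean v (`abs_log_norm_limit_sub_le`): put u = y/t^κ. On a circle |t| = s < |ξ| the |f_j(t^e)|
are nearly constant, so log|y| stays in an interval on which no term of a tropical polynomial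
dominates, and such intervals are short. The maximum principle for u and 1/u compares the circle
with u(0) = a_κ, and Abel's theorem carries the comparison to t = ξ.

Summed over v, each log(H/|c_j|_v) costs at most h_p(F) by the product formula
(`sum_gap_le_logHeight`), and the archimedean constants add up to one constant because the local
degrees at infinity sum to d. This gives the bound (n+1) h_p(F) + 10n + 6n log n, stronger than the
one required. Absolute irreducibility supplies f_0 ≠ 0. -/

/-- The coefficient of `Y ^ j` of a polynomial in `X = X₀` and `Y = X₁`. -/
noncomputable def yCoeff (F : MvPolynomial (Fin 2) K) (j : ℕ) : Polynomial K :=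
  ∑ k ∈ Finset.range (F.degreeOf 0 + 1),
    Polynomial.monomial k (F.coeff (Finsupp.single 0 k + Finsupp.single 1 j))

lemma coeff_yCoeff (F : MvPolynomial (Fin 2) K) (j k : ℕ) :
    (yCoeff F j).coeff k = F.coeff (Finsupp.single 0 k + Finsupp.single 1 j) := by
  rw [yCoeff, Polynomial.finsetSum_coeff]
  simp only [Polynomial.coeff_monomial]
  rw [Finset.sum_ite_eq' (Finset.range _) k]
  split_ifs with h
  · rfl
  · symm
    by_contra h0
    apply h
    have := MvPolynomial.monomial_le_degreeOf (0 : Fin 2) (MvPolynomial.mem_support_iff.2 h0)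
    simp at this
    simpa [Nat.lt_succ_iff] using this

lemma aeval_eq_sum_yCoeff {A : Type*} [CommRing A] [Algebra K A] (F : MvPolynomial (Fin 2) K)
    (a b : A) :
    MvPolynomial.aeval ![a, b] F =
      ∑ j ∈ Finset.range (F.degreeOf 1 + 1), Polynomial.aeval a (yCoeff F j) * b ^ j := by
  simp only [yCoeff, map_sum, Polynomial.aeval_monomial, Finset.sum_mul]
  rw [← Finset.sum_product', MvPolynomial.aeval_def, MvPolynomial.eval₂_eq']
  refine Finset.sum_of_injOn (fun d => (d 1, d 0)) ?_ ?_ ?_ ?_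
  · intro d _ d' _ h
    simp only [Prod.mk.injEq] at h
    ext i
    fin_cases i
    · exact h.2
    · exact h.1
  · intro d hd
    have h0 := MvPolynomial.monomial_le_degreeOf (0 : Fin 2) (Finset.mem_coe.1 hd)
    have h1 := MvPolynomial.monomial_le_degreeOf (1 : Fin 2) (Finset.mem_coe.1 hd)
    simp [h0, h1]
  · rintro ⟨j, k⟩ _ h
    have : F.coeff (Finsupp.single 0 k + Finsupp.single 1 j) = 0 := by
      by_contra h0
      exact h ⟨_, Finset.mem_coe.2 (MvPolynomial.mem_support_iff.2 h0), by simp⟩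
    simp [this]
  · intro d _
    have : Finsupp.single 0 (d 0) + Finsupp.single 1 (d 1) = d := by
      ext i
      fin_cases i <;> simp
    simp [this, mul_assoc]

/-- A polynomial in two variables that is irreducible over an algebraic closure and is not divisible
by `Y` has a nonzero coefficient of `Y ^ 0`. -/
lemma yCoeff_zero_ne_zero {F : MvPolynomial (Fin 2) K} (hF : AbsolutelyIrreducible F)
    {A : Type*} [CommRing A] [IsDomain A] [Algebra K A] {a b : A} (hb : b ≠ 0)
    (h : MvPolynomial.aeval ![a, b] F = 0) : yCoeff F 0 ≠ 0 := by
  intro h0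
  -- If Y divides F, irreducibility over the closure makes the cofactor a nonzero constant, and
  -- evaluation at (a, b) then forces b = 0.
  have hdvd : (MvPolynomial.X 1 : MvPolynomial (Fin 2) K) ∣ F := by
    rw [MvPolynomial.X_dvd_iff_modMonomial_eq_zero]
    ext d
    by_cases hd : Finsupp.single 1 1 ≤ d
    · simp [MvPolynomial.coeff_modMonomial_of_le _ hd]
    · rw [MvPolynomial.coeff_modMonomial_of_not_le _ hd]
      have h1 : d 1 = 0 := by
        by_contra h1
        apply hd
        rw [Finsupp.single_le_iff]
        omega
      have h2 : Finsupp.single 0 (d 0) + Finsupp.single 1 0 = d := by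
        ext i
        fin_cases i <;> simp [h1]
      have := coeff_yCoeff F 0 (d 0)
      rw [h0, h2] at this
      simpa using this.symm
  obtain ⟨G, rfl⟩ := hdvd
  unfold AbsolutelyIrreducible at hF
  rw [map_mul, MvPolynomial.map_X] at hF
  rcases hF.isUnit_or_isUnit rfl with hu | hu
  · exact MvPolynomial.X_prime.not_isUnit hu
  · obtain ⟨r, hr, hr'⟩ := MvPolynomial.isUnit_iff_eq_C_of_isReduced.1 hu
    have hG : G = MvPolynomial.C (G.coeff 0) := by
      ext d
      have := congrArg (MvPolynomial.coeff d) hr'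
      rw [MvPolynomial.coeff_map, MvPolynomial.coeff_C] at this
      rw [MvPolynomial.coeff_C]
      split_ifs with hd
      · rw [hd]
      · rw [if_neg hd] at this
        simpa using this
    have hG0 : G.coeff 0 ≠ 0 := by
      intro h0
      rw [h0, map_zero] at hG
      exact hF.ne_zero (by simp [hG])
    rw [map_mul, MvPolynomial.aeval_X, hG, MvPolynomial.aeval_C] at h
    simp [hb] at h
    exact hG0 h

/-- A polynomial with its trailing power of `X` split off. -/
lemma exists_eq_X_pow_natTrailingDegree_mul (f : Polynomial K) :
    ∃ g : Polynomial K, f = Polynomial.X ^ f.natTrailingDegree * g ∧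
      g.coeff 0 = f.trailingCoeff := by
  obtain ⟨g, hg⟩ : Polynomial.X ^ f.natTrailingDegree ∣ f :=
    Polynomial.X_pow_dvd_iff.2 fun d hd => Polynomial.coeff_eq_zero_of_lt_natTrailingDegree hd
  refine ⟨g, hg, ?_⟩
  have := congrArg (Polynomial.coeff · f.natTrailingDegree) hg
  simp only [Polynomial.coeff_X_pow_mul', le_refl, if_true, Nat.sub_self] at this
  exact this.symm

/-- The leading coefficient of a power series solution is a root of an edge polynomial. -/
lemma exists_edge_sum_eq_zero (f : ℕ → Polynomial K) (n e κ : ℕ) (he : 0 < e) (y : PowerSeries K)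
    (hκ : y.order = κ)
    (h : ∑ j ∈ Finset.range (n + 1), Polynomial.aeval (PowerSeries.X ^ e : PowerSeries K) (f j)
      * y ^ j = 0) (h0 : ∃ j ≤ n, f j ≠ 0) :
    ∃ J ⊆ Finset.range (n + 1), J.Nonempty ∧ (∀ j ∈ J, f j ≠ 0) ∧
      ∑ j ∈ J, (f j).trailingCoeff * PowerSeries.coeff κ y ^ j = 0 := by
  classical
  obtain ⟨u, hu⟩ : PowerSeries.X ^ κ ∣ y :=
    PowerSeries.X_pow_dvd_iff.2 fun d hd => PowerSeries.coeff_of_lt_order d (by rw [hκ]; exact_mod_cast hd)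
  have hu0 : PowerSeries.constantCoeff u = PowerSeries.coeff κ y := by
    rw [hu, PowerSeries.coeff_X_pow_mul']
    simp
  choose g hg hg0 using fun j => exists_eq_X_pow_natTrailingDegree_mul (f j)
  -- For f j ≠ 0 this is the order in t of the j-th term, whose lowest coefficient is c_j a_κ^j.
  set w : ℕ → ℕ := fun j => e * (f j).natTrailingDegree + j * κ with hw
  have hterm : ∀ j, Polynomial.aeval (PowerSeries.X ^ e : PowerSeries K) (f j) * y ^ j =
      PowerSeries.X ^ w j * (Polynomial.aeval (PowerSeries.X ^ e : PowerSeries K) (g j) * u ^ j) := by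
    intro j
    conv_lhs => rw [hg j, hu]
    simp only [map_mul, map_pow, Polynomial.aeval_X, hw, mul_pow, ← pow_mul, pow_add]
    rw [mul_comm κ j]
    ring
  have hconst : ∀ j, PowerSeries.constantCoeff
      (Polynomial.aeval (PowerSeries.X ^ e : PowerSeries K) (g j) * u ^ j) =
      (f j).trailingCoeff * PowerSeries.coeff κ y ^ j := by
    intro j
    rw [map_mul, map_pow, hu0, ← hg0 j]
    congr 1
    rw [Polynomial.aeval_def, Polynomial.hom_eval₂, Polynomial.coeff_zero_eq_eval_zero]
    simp only [map_pow, PowerSeries.constantCoeff_X, zero_pow he.ne']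
    have : (PowerSeries.constantCoeff (R := K)).comp (algebraMap K (PowerSeries K)) = RingHom.id K := by
      ext x
      simp
    rw [this]
    rfl
  set S := (Finset.range (n + 1)).filter fun j => f j ≠ 0 with hS
  have hSne : S.Nonempty := by
    obtain ⟨j, hj, hj0⟩ := h0
    exact ⟨j, by simp [hS, hj0, hj]⟩
  obtain ⟨i, hiS, hi⟩ := Finset.exists_min_image S w hSne
  -- The edge consists of the indices of minimal weight; the coefficient of t^(w i) in the equation
  -- is the edge polynomial at a_κ.
  refine ⟨S.filter fun j => w j = w i, ?_, ⟨i, by simp [hiS]⟩, ?_, ?_⟩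
  · exact (Finset.filter_subset _ _).trans (Finset.filter_subset _ _)
  · intro j hj
    simp only [hS, Finset.mem_filter] at hj
    exact hj.1.2
  · have h1 := congrArg (PowerSeries.coeff (w i)) h
    rw [map_sum, map_zero] at h1
    rw [← h1, hS, Finset.filter_filter, Finset.sum_filter]
    refine Finset.sum_congr rfl fun j hj => ?_
    rw [hterm, PowerSeries.coeff_X_pow_mul']
    by_cases hj0 : f j = 0
    · have : g j = 0 := by
        have := hg j
        rw [hj0] at this
        simpa using this.symm
      simp [hj0, this]
    · have hle := hi j (by simp only [hS, Finset.mem_filter]; exact ⟨hj, hj0⟩)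
      by_cases hji : w j = w i
      · rw [if_pos ⟨hj0, hji⟩, if_pos hji.le, hji, Nat.sub_self,
          PowerSeries.coeff_zero_eq_constantCoeff_apply, hconst]
      · rw [if_neg (by tauto), if_neg (by omega)]

end Algebra

/-! ### Cauchy's root bounds, uniform in the type of absolute value. -/

section RootBound

variable {K : Type*} [Field K]

/-- Cauchy's bounds for the size of a nonzero root of a polynomial, relative to one of its
coefficients each, when sums of at most `n` terms are at most `N` times the largest term. -/
lemma exists_root_bounds (v : AbsoluteValue K ℝ) {n : ℕ} {N H : ℝ} (hN1 : 1 ≤ N)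
    (hN : ∀ (s : Finset ℕ) (g : ℕ → K) (B : ℝ), s.card ≤ n → 0 ≤ B → (∀ i ∈ s, v (g i) ≤ B) →
      v (∑ i ∈ s, g i) ≤ N * B)
    {J : Finset ℕ} (hJ : J.Nonempty) (hcard : J.card ≤ n + 1) {c : ℕ → K} {a : K} (ha : a ≠ 0)
    (hc : ∀ j ∈ J, c j ≠ 0) (hH : ∀ j ∈ J, v (c j) ≤ H) (h : ∑ j ∈ J, c j * a ^ j = 0) :
    (∃ j ∈ J, v a * v (c j) ≤ N * H) ∧ ∃ j ∈ J, v (c j) ≤ N * H * v a := by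
  have hva : 0 < v a := v.pos ha
  have hH0 : 0 ≤ H := by
    obtain ⟨j, hj⟩ := hJ
    exact (v.nonneg _).trans (hH j hj)
  have herase : ∀ j ∈ J, v (c j) * v a ^ j = v (∑ i ∈ J.erase j, c i * a ^ i) := by
    intro j hj
    rw [← Finset.add_sum_erase _ _ hj] at h
    rw [← map_pow, ← map_mul, eq_neg_of_add_eq_zero_left h, v.map_neg]
  have hcard' : ∀ j ∈ J, (J.erase j).card ≤ n := fun j hj => by
    rw [Finset.card_erase_of_mem hj]
    omega
  constructor
  -- The top term is balanced against the others, at most n in number. Only |a| > 1 needs an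
  -- argument, and there J = {0} is excluded because c 0 ≠ 0.
  · refine ⟨J.max' hJ, J.max'_mem hJ, ?_⟩
    set j := J.max' hJ with hjdef
    have hj : j ∈ J := J.max'_mem hJ
    rcases le_or_gt (v a) 1 with h1 | h1
    · calc v a * v (c j) ≤ 1 * H := mul_le_mul h1 (hH j hj) (v.nonneg _) zero_le_one
        _ ≤ N * H := by gcongr
    · have hj1 : 1 ≤ j := by
        by_contra hj0
        have hj0 : j = 0 := by omega
        have hE : J.erase j = ∅ := by
          rw [Finset.erase_eq_empty_iff]
          right
          refine Finset.eq_singleton_iff_unique_mem.2 ⟨hj, fun i hi => ?_⟩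
          have := J.le_max' i hi
          omega
        have := herase j hj
        rw [hE] at this
        simp [hj0] at this
        exact hc 0 (hj0 ▸ hj) this
      have hle := hN (J.erase j) (fun i => c i * a ^ i) (H * v a ^ (j - 1)) (hcard' j hj)
        (by positivity) (fun i hi => by
          rw [map_mul, map_pow]
          have hij := J.lt_max'_of_mem_erase_max' hJ hi
          exact mul_le_mul (hH i (Finset.mem_of_mem_erase hi))
            (pow_le_pow_right₀ h1.le (by omega)) (by positivity) hH0)
      rw [← herase j hj] at hle
      have hpos : 0 < v a ^ (j - 1) := by positivity
      have hpow : v a ^ j = v a ^ (j - 1) * v a := by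
        rw [← pow_succ, Nat.sub_add_cancel hj1]
      rw [hpow] at hle
      nlinarith
  -- Symmetrically, the bottom term is isolated, and only |a| < 1 needs an argument.
  · refine ⟨J.min' hJ, J.min'_mem hJ, ?_⟩
    set j := J.min' hJ with hjdef
    have hj : j ∈ J := J.min'_mem hJ
    rcases le_or_gt 1 (v a) with h1 | h1
    · calc v (c j) ≤ 1 * H * 1 := by simpa using hH j hj
        _ ≤ N * H * v a := by gcongr
    · have hle := hN (J.erase j) (fun i => c i * a ^ i) (H * v a ^ (j + 1)) (hcard' j hj)
        (by positivity) (fun i hi => by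
          rw [map_mul, map_pow]
          have hij := J.min'_lt_of_mem_erase_min' hJ hi
          exact mul_le_mul (hH i (Finset.mem_of_mem_erase hi))
            (pow_le_pow_of_le_one hva.le h1.le (by omega)) (by positivity) hH0)
      rw [← herase j hj] at hle
      have hpos : 0 < v a ^ j := by positivity
      rw [pow_succ] at hle
      have : v (c j) * v a ^ j ≤ (N * H * v a) * v a ^ j := by linarith
      exact le_of_mul_le_mul_right this hpos

end RootBound

/-! ### Gauss norms and dominant terms at finite places. -/

section Nonarchimedean

variable {K : Type*} [Field K] {v : AbsoluteValue K ℝ}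

lemma sum_le_of_isNonarchimedean (hv : IsNonarchimedean v) {ι : Type*} (s : Finset ι) (g : ι → K)
    {B : ℝ} (hB : 0 ≤ B) (h : ∀ i ∈ s, v (g i) ≤ B) : v (∑ i ∈ s, g i) ≤ B := by
  classical
  induction s using Finset.induction_on with
  | empty => simpa using hB
  | insert i s hi ih =>
    rw [Finset.sum_insert hi]
    exact (hv _ _).trans (max_le (h i (by simp)) (ih fun j hj => h j (by simp [hj])))

lemma sum_lt_of_isNonarchimedean (hv : IsNonarchimedean v) {ι : Type*} (s : Finset ι) (g : ι → K)
    {B : ℝ} (hB : 0 < B) (h : ∀ i ∈ s, v (g i) < B) : v (∑ i ∈ s, g i) < B := by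
  classical
  induction s using Finset.induction_on with
  | empty => simpa using hB
  | insert i s hi ih =>
    rw [Finset.sum_insert hi]
    exact (hv _ _).trans_lt (max_lt (h i (by simp)) (ih fun j hj => h j (by simp [hj])))

/-- The power series over a field with a nonarchimedean absolute value whose coefficients tend
to `0`. -/
def nullSubring (hv : IsNonarchimedean v) : Subring (PowerSeries K) where
  carrier := {a | Tendsto (fun k => v (PowerSeries.coeff k a)) atTop (𝓝 0)}
  zero_mem' := by simp
  one_mem' := by
    refine tendsto_const_nhds.congr' ?_
    filter_upwards [eventually_gt_atTop 0] with k hk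
    simp [PowerSeries.coeff_one, hk.ne']
  add_mem' := by
    intro a b ha hb
    refine squeeze_zero (fun _ => v.nonneg _) (fun k => ?_) (by simpa using ha.add hb)
    rw [map_add]
    exact v.add_le _ _
  neg_mem' := by
    intro a ha
    simpa using ha
  mul_mem' := by
    intro a b ha hb
    obtain ⟨A, hA⟩ := ha.bddAbove_range
    obtain ⟨B, hB⟩ := hb.bddAbove_range
    have hA' : ∀ k, v (PowerSeries.coeff k a) ≤ |A| + 1 := fun k =>
      (hA ⟨k, rfl⟩).trans ((le_abs_self A).trans (by linarith))
    have hB' : ∀ k, v (PowerSeries.coeff k b) ≤ |B| + 1 := fun k =>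
      (hB ⟨k, rfl⟩).trans ((le_abs_self B).trans (by linarith))
    rw [Set.mem_ofPred_eq, Metric.tendsto_atTop]
    intro ε hε
    obtain ⟨N₁, h₁⟩ := eventually_atTop.1 (ha.eventually_lt_const
      (show 0 < ε / (|B| + 1) by positivity))
    obtain ⟨N₂, h₂⟩ := eventually_atTop.1 (hb.eventually_lt_const
      (show 0 < ε / (|A| + 1) by positivity))
    refine ⟨N₁ + N₂, fun k hk => ?_⟩
    rw [Real.dist_0_eq_abs, abs_of_nonneg (v.nonneg _), PowerSeries.coeff_mul]
    refine sum_lt_of_isNonarchimedean hv _ _ hε fun p hp => ?_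
    rw [Finset.HasAntidiagonal.mem_antidiagonal] at hp
    rw [map_mul]
    -- Since the indices add up to at least N₁ + N₂, one factor is small while the other is bounded.
    rcases le_or_gt N₁ p.1 with h | h
    · calc v (PowerSeries.coeff p.1 a) * v (PowerSeries.coeff p.2 b)
          ≤ v (PowerSeries.coeff p.1 a) * (|B| + 1) := by gcongr; exact hB' _
        _ < ε / (|B| + 1) * (|B| + 1) := by gcongr; exact h₁ _ h
        _ = ε := by field_simp
    · calc v (PowerSeries.coeff p.1 a) * v (PowerSeries.coeff p.2 b)
          ≤ (|A| + 1) * v (PowerSeries.coeff p.2 b) := by gcongr; exact hA' _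
        _ < (|A| + 1) * (ε / (|A| + 1)) := by gcongr; exact h₂ _ (by omega)
        _ = ε := by field_simp

lemma mem_nullSubring (hv : IsNonarchimedean v) {a : PowerSeries K} :
    a ∈ nullSubring hv ↔ Tendsto (fun k => v (PowerSeries.coeff k a)) atTop (𝓝 0) := Iff.rfl

lemma mem_nullSubring_of_coeff_eq_zero (hv : IsNonarchimedean v) {a : PowerSeries K} {N : ℕ}
    (h : ∀ k, N < k → PowerSeries.coeff k a = 0) : a ∈ nullSubring hv := by
  rw [mem_nullSubring]
  refine tendsto_const_nhds.congr' ?_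
  filter_upwards [eventually_gt_atTop N] with k hk
  simp [h k hk]

/-- The last index at which a null sequence attains its maximal absolute value. -/
lemma exists_last_max (hv : IsNonarchimedean v) {a : PowerSeries K} (ha : a ∈ nullSubring hv)
    (ha0 : a ≠ 0) : ∃ L, (∀ k, v (PowerSeries.coeff k a) ≤ v (PowerSeries.coeff L a)) ∧
      (∀ k, L < k → v (PowerSeries.coeff k a) < v (PowerSeries.coeff L a)) ∧
      0 < v (PowerSeries.coeff L a) := by
  obtain ⟨i, hi⟩ := PowerSeries.exists_coeff_ne_zero_iff_ne_zero.2 ha0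
  have hpos := v.pos hi
  obtain ⟨N, hN⟩ := eventually_atTop.1 ((mem_nullSubring hv).1 ha |>.eventually_lt_const hpos)
  have hiN : i < N := by
    by_contra h
    exact lt_irrefl _ (hN i (not_lt.1 h))
  obtain ⟨j, hj, hjmax⟩ := Finset.exists_max_image (Finset.range N)
    (fun k => v (PowerSeries.coeff k a)) ⟨i, by simpa⟩
  have hij := hjmax i (by simpa)
  have hmax : ∀ k, v (PowerSeries.coeff k a) ≤ v (PowerSeries.coeff j a) := by
    intro k
    rcases lt_or_ge k N with hk | hk
    · exact hjmax k (by simpa)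
    · exact (hN k hk).le.trans hij
  classical
  set S := (Finset.range N).filter fun k => v (PowerSeries.coeff k a) = v (PowerSeries.coeff j a)
    with hS
  have hSne : S.Nonempty := ⟨j, by simpa [hS] using hj⟩
  have hL : v (PowerSeries.coeff (S.max' hSne) a) = v (PowerSeries.coeff j a) :=
    (Finset.mem_filter.1 (S.max'_mem hSne)).2
  refine ⟨S.max' hSne, fun k => hL ▸ hmax k, fun k hk => ?_, hL ▸ hpos.trans_le hij⟩
  rw [hL]
  refine lt_of_le_of_ne (hmax k) fun h => ?_
  rcases lt_or_ge k N with hkN | hkN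
  · exact absurd (S.le_max' k (by simp [hS, hkN, h])) (not_le.2 hk)
  · exact absurd (hN k hkN) (not_lt.2 (h ▸ hij))

/-- If the coefficients of a product of two null power series have their maximal absolute value at
the order of the product and only there, then the same is true of the factors. -/
lemma coeff_lt_of_mul (hv : IsNonarchimedean v) {a b : PowerSeries K} (ha : a ∈ nullSubring hv)
    (hb : b ∈ nullSubring hv) {κ N : ℕ} (hκ : a.order = κ) (hN : (a * b).order = N)
    (h : ∀ k, N < k → v (PowerSeries.coeff k (a * b)) < v (PowerSeries.coeff N (a * b)))
    (k : ℕ) (hk : κ < k) : v (PowerSeries.coeff k a) < v (PowerSeries.coeff κ a) := by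
  have hab : a * b ≠ 0 := by
    rintro h0
    simp [h0] at hN
  have ha0 := left_ne_zero_of_mul hab
  have hb0 := right_ne_zero_of_mul hab
  obtain ⟨L, hL, hL', hLpos⟩ := exists_last_max hv ha ha0
  obtain ⟨M, hM, hM', hMpos⟩ := exists_last_max hv hb hb0
  have hbM : b.order ≤ M := PowerSeries.order_le M fun h0 => by simp [h0] at hMpos
  have haL : a.order ≤ L := PowerSeries.order_le L fun h0 => by simp [h0] at hLpos
  have hκL : κ ≤ L := by rw [hκ] at haL; exact_mod_cast haL
  suffices L = κ by
    subst this
    exact hL' k hk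
  by_contra hne
  -- With L and M the last maximal indices of a and b, the term (L, M) strictly dominates the
  -- coefficient of the product at L + M. If L ≠ κ, then L + M lies beyond the order N, yet that
  -- coefficient is at least as large as the one at N.
  have hNlt : N < L + M := by
    rw [PowerSeries.order_mul, hκ] at hN
    have hb1 : b.order = (b.order.toNat : ℕ∞) := (PowerSeries.coe_toNat_order hb0).symm
    rw [hb1] at hbM hN
    norm_cast at hbM hN
    omega
  have hle : v (PowerSeries.coeff N (a * b)) ≤
      v (PowerSeries.coeff L a) * v (PowerSeries.coeff M b) := by
    rw [PowerSeries.coeff_mul]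
    refine sum_le_of_isNonarchimedean hv _ _ (by positivity) fun p _ => ?_
    rw [map_mul]
    exact mul_le_mul (hL _) (hM _) (v.nonneg _) (v.nonneg _)
  have hge : v (PowerSeries.coeff L a) * v (PowerSeries.coeff M b) ≤
      v (PowerSeries.coeff (L + M) (a * b)) := by
    rw [PowerSeries.coeff_mul, ← Finset.add_sum_erase _ _
      (show (L, M) ∈ Finset.HasAntidiagonal.antidiagonal (L + M) by simp), ← map_mul]
    set x := PowerSeries.coeff L a * PowerSeries.coeff M b
    have hx : 0 < v x := by simp only [x, map_mul]; positivity
    set r := ∑ p ∈ (Finset.HasAntidiagonal.antidiagonal (L + M)).erase (L, M),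
      PowerSeries.coeff p.1 a * PowerSeries.coeff p.2 b with hr
    have hlt : v r < v x := by
      refine sum_lt_of_isNonarchimedean hv _ _ hx fun p hp => ?_
      rw [Finset.mem_erase, Finset.HasAntidiagonal.mem_antidiagonal] at hp
      simp only [x, map_mul]
      rcases lt_trichotomy p.1 L with h1 | h1 | h1
      · have h2 : M < p.2 := by omega
        exact (mul_le_mul_of_nonneg_right (hL _) (v.nonneg _)).trans_lt
          (mul_lt_mul_of_pos_left (hM' _ h2) hLpos)
      · exact absurd (Prod.ext h1 (by simp; omega)) hp.1
      · exact (mul_le_mul_of_nonneg_left (hM _) (v.nonneg _)).trans_lt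
          (mul_lt_mul_of_pos_right (hL' _ h1) hMpos)
    have h3 := hv (x + r) (-r)
    rw [add_neg_cancel_right, v.map_neg] at h3
    rcases le_max_iff.1 h3 with h4 | h4
    · exact h4
    · exact absurd h4 (not_le.2 hlt)
  exact absurd (h _ hNlt) (not_lt.2 (hle.trans hge))

/-- If the coefficient of lowest order of a series strictly dominates, then so it does the sum. -/
lemma apply_limit_eq (hv : IsNonarchimedean v) {a : PowerSeries K} {κ : ℕ} (hκ : a.order = κ)
    (h : ∀ k, κ < k → v (PowerSeries.coeff k a) < v (PowerSeries.coeff κ a)) {b : K}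
    (hlim : Tendsto (fun N => v ((∑ k ∈ Finset.range N, PowerSeries.coeff k a) - b)) atTop (𝓝 0)) :
    v b = v (PowerSeries.coeff κ a) := by
  have hpos : 0 < v (PowerSeries.coeff κ a) := v.pos (PowerSeries.order_eq_nat.1 hκ).1
  -- A single partial sum, closer to b than the size of the leading term, suffices by the
  -- ultrametric inequality.
  obtain ⟨N, hN, hκN⟩ := ((hlim.eventually_lt_const hpos).and (eventually_gt_atTop κ)).exists
  rw [← Finset.add_sum_erase _ _ (Finset.mem_range.2 hκN)] at hN
  set x := PowerSeries.coeff κ a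
  set r := ∑ k ∈ (Finset.range N).erase κ, PowerSeries.coeff k a with hr
  have hlt : v r < v x := by
    refine sum_lt_of_isNonarchimedean hv _ _ hpos fun k hk => ?_
    rcases lt_or_ge κ k with h1 | h1
    · exact h k h1
    · have : k < κ := lt_of_le_of_ne h1 (Finset.ne_of_mem_erase hk)
      rw [PowerSeries.coeff_of_lt_order k (by rw [hκ]; exact_mod_cast this)]
      simpa using hpos
  have hlt' : v (r - (x + r - b)) < v x := by
    have := hv r (-(x + r - b))
    rw [← sub_eq_add_neg, v.map_neg] at this
    exact this.trans_lt (max_lt hlt hN)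
  have e : r - (x + r - b) = b - x := by ring
  rw [e] at hlt'
  apply le_antisymm
  · have := hv (b - x) x
    rw [sub_add_cancel] at this
    exact this.trans (max_le hlt'.le le_rfl)
  · have := hv b (-(b - x))
    rw [show b + -(b - x) = x by ring, v.map_neg] at this
    rcases le_max_iff.1 this with h4 | h4
    · exact h4
    · exact absurd h4 (not_le.2 hlt')

lemma coeff_aeval_X_pow (f : Polynomial K) {e : ℕ} (he : 0 < e) (k : ℕ) :
    PowerSeries.coeff k (Polynomial.aeval (PowerSeries.X ^ e : PowerSeries K) f) =
      if e ∣ k then f.coeff (k / e) else 0 := by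
  have h : Polynomial.aeval (PowerSeries.X ^ e : PowerSeries K) f =
      (Polynomial.expand K e f : PowerSeries K) := by
    rw [Polynomial.expand_eq_sum, Polynomial.aeval_eq_sum_range, Polynomial.sum_over_range _ (by simp)]
    rw [← Polynomial.coeToPowerSeries.ringHom_apply, map_sum]
    refine Finset.sum_congr rfl fun i _ => ?_
    simp [PowerSeries.smul_eq_C_mul]
  rw [h, Polynomial.coeff_coe, Polynomial.coeff_expand he]

/-- At a point of convergence close to the origin, the absolute value of the sum of a power series
solution is that of its leading term. -/
lemma apply_eq_of_isNonarchimedean (hv : IsNonarchimedean v) {f : ℕ → Polynomial K} {n e κ : ℕ}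
    (he : 0 < e) {y : PowerSeries K} (hκ : y.order = κ)
    (h : ∑ j ∈ Finset.range (n + 1), Polynomial.aeval (PowerSeries.X ^ e : PowerSeries K) (f j)
      * y ^ j = 0) (h0 : f 0 ≠ 0) {H : ℝ} (hH : ∀ k, v ((f 0).coeff k) ≤ H) {ξ β : K} (hξ : ξ ≠ 0)
    (hsmall : v (ξ ^ e) * H < v (f 0).trailingCoeff)
    (hlim : Tendsto (fun N => v ((∑ k ∈ Finset.range N, PowerSeries.coeff k y * ξ ^ k) - β))
      atTop (𝓝 0)) :
    v β = v (PowerSeries.coeff κ y) * v ξ ^ κ := by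
  -- Rescaling moves the evaluation point to 1, so that convergence makes the coefficients a null
  -- sequence.
  set a := PowerSeries.rescale ξ y with ha
  have hcoeff : ∀ k, PowerSeries.coeff k a = PowerSeries.coeff k y * ξ ^ k := fun k => by
    rw [ha, PowerSeries.coeff_rescale, mul_comm]
  have haκ : a.order = κ := by
    rw [PowerSeries.order_eq_nat] at hκ ⊢
    refine ⟨?_, fun i hi => ?_⟩
    · rw [hcoeff]
      exact mul_ne_zero hκ.1 (pow_ne_zero _ hξ)
    · rw [hcoeff, hκ.2 i hi, zero_mul]
  have hlim' : Tendsto (fun N => v ((∑ k ∈ Finset.range N, PowerSeries.coeff k a) - β))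
      atTop (𝓝 0) := by
    simpa only [hcoeff] using hlim
  have hanull : a ∈ nullSubring hv := by
    rw [mem_nullSubring]
    refine squeeze_zero (fun _ => v.nonneg _) (fun k => ?_)
      (by simpa using (hlim'.comp (tendsto_add_atTop_nat 1)).add hlim')
    have := v.add_le ((∑ i ∈ Finset.range (k + 1), PowerSeries.coeff i a) - β)
      (-((∑ i ∈ Finset.range k, PowerSeries.coeff i a) - β))
    rw [v.map_neg] at this
    refine le_trans (le_of_eq ?_) this
    congr 1
    rw [Finset.sum_range_succ]
    ring
  have hpoly : ∀ g : Polynomial K, PowerSeries.rescale ξ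
      (Polynomial.aeval (PowerSeries.X ^ e : PowerSeries K) g) ∈ nullSubring hv := by
    intro g
    refine mem_nullSubring_of_coeff_eq_zero hv (N := e * g.natDegree) fun k hk => ?_
    rw [PowerSeries.coeff_rescale, coeff_aeval_X_pow _ he]
    split_ifs with hek
    · obtain ⟨l, rfl⟩ := hek
      rw [Nat.mul_div_cancel_left _ he,
        Polynomial.coeff_eq_zero_of_natDegree_lt (lt_of_mul_lt_mul_left hk (Nat.zero_le e)), mul_zero]
    · rw [mul_zero]
  -- The equation reads f_0 = y · (-∑ f_(j+1) y^j); this is the cofactor of y after rescaling.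
  set b := -∑ j ∈ Finset.range n, PowerSeries.rescale ξ
    (Polynomial.aeval (PowerSeries.X ^ e : PowerSeries K) (f (j + 1))) * a ^ j with hb
  have hbnull : b ∈ nullSubring hv :=
    neg_mem (sum_mem fun j _ => mul_mem (hpoly _) (pow_mem hanull j))
  have hab : a * b = PowerSeries.rescale ξ
      (Polynomial.aeval (PowerSeries.X ^ e : PowerSeries K) (f 0)) := by
    have := congrArg (PowerSeries.rescale ξ) h
    rw [map_sum, map_zero, Finset.sum_range_succ'] at this
    simp only [map_mul, map_pow, ← ha, pow_zero, mul_one] at this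
    rw [hb, mul_neg, Finset.mul_sum, eq_comm, ← sub_eq_zero, sub_neg_eq_add, ← this, add_comm]
    congr 1
    refine Finset.sum_congr rfl fun j _ => ?_
    ring
  set μ := (f 0).natTrailingDegree with hμ
  have hc : ∀ k, PowerSeries.coeff k (a * b) =
      ξ ^ k * if e ∣ k then (f 0).coeff (k / e) else 0 := fun k => by
    rw [hab, PowerSeries.coeff_rescale, coeff_aeval_X_pow _ he]
  have hcμ : PowerSeries.coeff (e * μ) (a * b) = ξ ^ (e * μ) * (f 0).trailingCoeff := by
    rw [hc, if_pos (dvd_mul_right _ _), Nat.mul_div_cancel_left _ he]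
    rfl
  have htc : (f 0).trailingCoeff ≠ 0 := Polynomial.trailingCoeff_nonzero_iff_nonzero.2 h0
  have hvξ : 0 < v (ξ ^ e) := v.pos (pow_ne_zero _ hξ)
  have htcH : v (f 0).trailingCoeff ≤ H := hH _
  have hH0 : 0 < H := (v.pos htc).trans_le htcH
  -- Because |ξ^e| H < |c_0| ≤ H.
  have hξ1 : v (ξ ^ e) ≤ 1 := by
    by_contra hlt
    nlinarith
  have hab_order : (a * b).order = (e * μ : ℕ) := by
    rw [PowerSeries.order_eq_nat, hcμ]
    refine ⟨mul_ne_zero (pow_ne_zero _ hξ) htc, fun i hi => ?_⟩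
    rw [hc]
    split_ifs with hei
    · obtain ⟨l, rfl⟩ := hei
      rw [Nat.mul_div_cancel_left _ he,
        Polynomial.coeff_eq_zero_of_lt_natTrailingDegree (lt_of_mul_lt_mul_left hi (Nat.zero_le e)),
        mul_zero]
    · rw [mul_zero]
  -- Beyond its order e·μ, the rescaled f_0 has coefficients of size at most |ξ^e|^(μ+1) H, less
  -- than that of the trailing term.
  have hdom := coeff_lt_of_mul hv hanull hbnull haκ hab_order (fun k hk => by
    rw [hcμ, hc, map_mul, map_mul, pow_mul, map_pow v (ξ ^ e)]
    split_ifs with hek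
    · obtain ⟨l, rfl⟩ := hek
      have hl : μ + 1 ≤ l := lt_of_mul_lt_mul_left hk (Nat.zero_le e)
      rw [Nat.mul_div_cancel_left _ he, pow_mul, map_pow v (ξ ^ e)]
      calc v (ξ ^ e) ^ l * v ((f 0).coeff l) ≤ v (ξ ^ e) ^ (μ + 1) * H :=
            mul_le_mul (pow_le_pow_of_le_one hvξ.le hξ1 hl) (hH l) (v.nonneg _) (by positivity)
        _ = v (ξ ^ e) ^ μ * (v (ξ ^ e) * H) := by ring
        _ < v (ξ ^ e) ^ μ * v (f 0).trailingCoeff := by gcongr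
    · rw [map_zero, mul_zero]
      have := v.pos htc
      positivity)
  rw [apply_limit_eq hv haκ hdom hlim', hcoeff, map_mul, map_pow]

end Nonarchimedean

/-! ### Oscillation on circles at infinite places: tropical bounds. -/

section Archimedean

/-- If no term of a tropical polynomial of degree at most `n` exceeds all others by more than `δ` at
any point of an interval, then the interval has length at most `2 * (n + 1) * δ`. -/
lemma sub_le_of_forall_not_dominant {n : ℕ} {B : ℕ → ℝ} (hB : ∀ j, 0 ≤ B j) (hB0 : 0 < B 0)
    {δ : ℝ} (hδ : 0 ≤ δ) {p q : ℝ}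
    (h : ∀ w ∈ Set.Icc p q, ∀ j ≤ n, ∃ i ≤ n, i ≠ j ∧
      B j * Real.exp (j * w) ≤ Real.exp δ * (B i * Real.exp (i * w))) :
    q - p ≤ 2 * (n + 1) * δ := by
  by_contra! hlt
  set s : ℝ := (q - p) / (n + 1) with hs
  have hn : (0 : ℝ) < n + 1 := by positivity
  have hs2 : 2 * δ < s := by
    rw [hs, lt_div_iff₀ hn]
    linarith
  have hqp : q - p = (n + 1) * s := by
    rw [hs]
    field_simp
  -- Among n + 2 equally spaced points, two share a maximal term j by pigeonhole. At their midpoint,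
  -- integrality of the slopes makes j exceed every other term by half the distance: those of
  -- smaller slope are compared from the left point, those of larger slope from the right.
  have hmax : ∀ k : ℕ, ∃ j ∈ Finset.range (n + 1), ∀ i ∈ Finset.range (n + 1),
      B i * Real.exp (i * (p + k * s)) ≤ B j * Real.exp (j * (p + k * s)) := fun k =>
    Finset.exists_max_image _ (fun i : ℕ => B i * Real.exp (i * (p + k * s))) ⟨0, by simp⟩
  choose m hm hmm using hmax
  obtain ⟨k, hk, l, hl, hkl, hmkl⟩ : ∃ k ∈ Finset.range (n + 2), ∃ l ∈ Finset.range (n + 2),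
      k < l ∧ m k = m l := by
    obtain ⟨k, hk, l, hl, hne, he⟩ := Finset.exists_ne_map_eq_of_card_lt_of_maps_to
      (s := Finset.range (n + 2)) (t := Finset.range (n + 1)) (f := m) (by simp)
      (fun k _ => hm k)
    rcases lt_or_gt_of_ne hne with h1 | h1
    · exact ⟨k, hk, l, hl, h1, he⟩
    · exact ⟨l, hl, k, hk, h1, he.symm⟩
  set j := m k with hj
  have hkl' : (k : ℝ) + 1 ≤ l := by exact_mod_cast hkl
  have hln : (l : ℝ) ≤ n + 1 := by
    have := Finset.mem_range.1 hl
    exact_mod_cast Nat.lt_succ_iff.1 this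
  have hs0 : 0 < s := by linarith
  set r : ℝ := (l - k) * s / 2 with hr
  have hrδ : δ < r := by rw [hr]; nlinarith
  set w : ℝ := p + k * s + r with hw
  have hw' : w = p + l * s - r := by rw [hw, hr]; ring
  have hk0 : (0 : ℝ) ≤ k := Nat.cast_nonneg k
  have hr0 : 0 < r := hδ.trans_lt hrδ
  have hwI : w ∈ Set.Icc p q := by
    constructor
    · rw [hw]; nlinarith
    · rw [hw']; nlinarith
  have hBj : 0 < B j := by
    by_contra hBj
    have h1 := hmm k 0 (by simp)
    have h2 : B j = 0 := le_antisymm (not_lt.1 hBj) (hB j)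
    rw [← hj, h2] at h1
    simp at h1
    linarith
  obtain ⟨i, hi, hij, hle⟩ := h w hwI j (Nat.lt_succ_iff.1 (Finset.mem_range.1 (hm k)))
  have hi' : i ∈ Finset.range (n + 1) := Finset.mem_range.2 (Nat.lt_succ_iff.2 hi)
  have key : B i * Real.exp (i * w) ≤ Real.exp (-r) * (B j * Real.exp (j * w)) := by
    rcases lt_or_gt_of_ne hij with h1 | h1
    · have h2 : (i : ℝ) + 1 ≤ j := by exact_mod_cast h1
      calc B i * Real.exp (i * w) = B i * Real.exp (i * (p + k * s)) * Real.exp (i * r) := by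
            rw [mul_assoc, ← Real.exp_add, hw]; ring_nf
        _ ≤ B j * Real.exp (j * (p + k * s)) * Real.exp (-r + j * r) := by
            refine mul_le_mul (hmm k i hi') (Real.exp_le_exp.2 ?_) (Real.exp_pos _).le
              (mul_nonneg (hB _) (Real.exp_pos _).le)
            nlinarith
        _ = Real.exp (-r) * (B j * Real.exp (j * w)) := by
            rw [mul_assoc, ← Real.exp_add, mul_left_comm, ← Real.exp_add, hw]; ring_nf
    · have h2 : (j : ℝ) + 1 ≤ i := by exact_mod_cast h1
      have h3 := hmm l i hi'
      rw [← hmkl] at h3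
      calc B i * Real.exp (i * w) = B i * Real.exp (i * (p + l * s)) * Real.exp (-(i * r)) := by
            rw [mul_assoc, ← Real.exp_add, hw']; ring_nf
        _ ≤ B j * Real.exp (j * (p + l * s)) * Real.exp (-r - j * r) := by
            refine mul_le_mul h3 (Real.exp_le_exp.2 ?_) (Real.exp_pos _).le
              (mul_nonneg (hB _) (Real.exp_pos _).le)
            nlinarith
        _ = Real.exp (-r) * (B j * Real.exp (j * w)) := by
            rw [mul_assoc, ← Real.exp_add, mul_left_comm, ← Real.exp_add, hw']; ring_nf
  have hpos : 0 < B j * Real.exp (j * w) := by positivity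
  have h4 : B j * Real.exp (j * w) ≤ Real.exp (δ - r) * (B j * Real.exp (j * w)) := by
    calc _ ≤ _ := hle
      _ ≤ Real.exp δ * (Real.exp (-r) * (B j * Real.exp (j * w))) := by gcongr
      _ = _ := by rw [← mul_assoc, ← Real.exp_add, sub_eq_add_neg]
  have h5 : Real.exp (δ - r) < 1 := by
    rw [← Real.exp_zero]
    exact Real.exp_lt_exp.2 (by linarith)
  nlinarith

/-- If the coefficients of an equation of degree at most `n` have nearly constant absolute values,
then the absolute value of a continuous solution on a connected set varies little. -/
lemma log_norm_sub_log_norm_le {X : Type*} [TopologicalSpace X] {S : Set X} (hS : IsPreconnected S)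
    {n : ℕ} (hn : 1 ≤ n) {B : ℕ → ℝ} (hB : ∀ j, 0 ≤ B j) (hB0 : 0 < B 0) {b : X → ℕ → ℂ}
    (hb : ∀ t ∈ S, ∀ j ≤ n, B j / 2 ≤ ‖b t j‖ ∧ ‖b t j‖ ≤ 3 / 2 * B j) {Y : X → ℂ}
    (hY : ContinuousOn Y S) (hY0 : ∀ t ∈ S, Y t ≠ 0)
    (h : ∀ t ∈ S, ∑ j ∈ Finset.range (n + 1), b t j * Y t ^ j = 0) {t t' : X} (ht : t ∈ S)
    (ht' : t' ∈ S) :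
    Real.log ‖Y t'‖ - Real.log ‖Y t‖ ≤ 2 * (n + 1) * Real.log (3 * n) := by
  have hn' : (1 : ℝ) ≤ n := by exact_mod_cast hn
  have hcont : ContinuousOn (fun t => Real.log ‖Y t‖) S :=
    hY.norm.log fun t ht => norm_ne_zero_iff.2 (hY0 t ht)
  have hconn := hS.image _ hcont
  refine sub_le_of_forall_not_dominant hB hB0 (Real.log_nonneg (by linarith)) fun w hw j hj => ?_
  obtain ⟨x, hx, rfl⟩ := hconn.Icc_subset ⟨t, ht, rfl⟩ ⟨t', ht', rfl⟩ hw
  have hYpos : 0 < ‖Y x‖ := norm_pos_iff.2 (hY0 x hx)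
  have hexp : ∀ i : ℕ, Real.exp (i * Real.log ‖Y x‖) = ‖Y x‖ ^ i := fun i => by
    rw [Real.exp_nat_mul, Real.exp_log hYpos]
  simp only [hexp]
  rw [Real.exp_log (by linarith)]
  -- The factor 3n is (3/2)·2·n. If term j dominated by it, each of the n other terms would be below
  -- B_j |Y|^j/(2n), so their sum would be below the lower bound B_j |Y|^j/2 for term j.
  by_contra! hcon
  have hj' : j ∈ Finset.range (n + 1) := Finset.mem_range.2 (Nat.lt_succ_iff.2 hj)
  have h1 := h x hx
  rw [← Finset.add_sum_erase _ _ hj'] at h1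
  have h2 : ‖b x j * Y x ^ j‖ ≤ ∑ i ∈ (Finset.range (n + 1)).erase j, ‖b x i * Y x ^ i‖ := by
    rw [eq_neg_of_add_eq_zero_left h1, norm_neg]
    exact norm_sum_le _ _
  have hcard : ((Finset.range (n + 1)).erase j).card = n := by
    rw [Finset.card_erase_of_mem hj', Finset.card_range, Nat.add_sub_cancel]
  have hne : ((Finset.range (n + 1)).erase j).Nonempty := by
    rw [← Finset.card_pos, hcard]
    omega
  have h3 : ∑ i ∈ (Finset.range (n + 1)).erase j, ‖b x i * Y x ^ i‖ <
      ∑ i ∈ (Finset.range (n + 1)).erase j, B j * ‖Y x‖ ^ j / (2 * n) := by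
    refine Finset.sum_lt_sum_of_nonempty hne fun i hi => ?_
    have hi1 : i ≤ n := Nat.lt_succ_iff.1 (Finset.mem_range.1 (Finset.mem_of_mem_erase hi))
    have h4 := hcon i hi1 (Finset.ne_of_mem_erase hi)
    rw [norm_mul, norm_pow, lt_div_iff₀ (by positivity)]
    have h5 := mul_le_mul_of_nonneg_right (hb x hx i hi1).2 (pow_pos hYpos i).le
    calc ‖b x i‖ * ‖Y x‖ ^ i * (2 * n) ≤ 3 / 2 * B i * ‖Y x‖ ^ i * (2 * n) := by gcongr
      _ = 3 * n * (B i * ‖Y x‖ ^ i) := by ring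
      _ < _ := h4
  rw [Finset.sum_const, hcard, nsmul_eq_mul, norm_mul, norm_pow] at *
  have h6 : (n : ℝ) * (B j * ‖Y x‖ ^ j / (2 * n)) = B j / 2 * ‖Y x‖ ^ j := by field_simp
  have h7 := mul_le_mul_of_nonneg_right (hb x hx j hj).1 (pow_pos hYpos j).le
  linarith

/-- Close to the origin, a complex polynomial is dominated by its trailing term. -/
lemma norm_eval_bounds {f : Polynomial ℂ} {H : ℝ} (hH : ∀ k, ‖f.coeff k‖ ≤ H) {x : ℂ}
    (hx : f ≠ 0 → 4 * ‖x‖ * H ≤ ‖f.trailingCoeff‖) :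
    ‖f.trailingCoeff‖ * ‖x‖ ^ f.natTrailingDegree / 2 ≤ ‖f.eval x‖ ∧
      ‖f.eval x‖ ≤ 3 / 2 * (‖f.trailingCoeff‖ * ‖x‖ ^ f.natTrailingDegree) := by
  rcases eq_or_ne f 0 with rfl | hf
  · simp
  have hx := hx hf
  set c := f.trailingCoeff with hc
  set μ := f.natTrailingDegree with hμ
  have hc0 : 0 < ‖c‖ := norm_pos_iff.2 (Polynomial.trailingCoeff_nonzero_iff_nonzero.2 hf)
  have hcH : ‖c‖ ≤ H := hH _
  have hx1 : ‖x‖ ≤ 1 / 4 := by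
    by_contra! hlt
    nlinarith
  obtain ⟨g, hg, hg0⟩ := exists_eq_X_pow_natTrailingDegree_mul f
  have hgH : ∀ k, ‖g.coeff k‖ ≤ H := by
    intro k
    have := hH (k + μ)
    rw [hg, ← hμ, Polynomial.coeff_X_pow_mul] at this
    exact this
  -- As |x| ≤ 1/2, the tail is at most |x| H times a geometric sum bounded by 2; the 4 in the
  -- hypothesis makes this |c|/2.
  have hsum : ‖g.eval x - c‖ ≤ ‖c‖ / 2 := by
    rw [Polynomial.eval_eq_sum_range, Finset.sum_range_succ', pow_zero, mul_one, hg0, ← hc,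
      add_sub_cancel_right]
    calc ‖∑ k ∈ Finset.range g.natDegree, g.coeff (k + 1) * x ^ (k + 1)‖
        ≤ ∑ k ∈ Finset.range g.natDegree, ‖g.coeff (k + 1) * x ^ (k + 1)‖ := norm_sum_le _ _
      _ ≤ ∑ k ∈ Finset.range g.natDegree, (‖x‖ * H) * (1 / 2 : ℝ) ^ k := by
          refine Finset.sum_le_sum fun k _ => ?_
          rw [norm_mul, norm_pow, pow_succ]
          calc ‖g.coeff (k + 1)‖ * (‖x‖ ^ k * ‖x‖) ≤ H * ((1 / 2 : ℝ) ^ k * ‖x‖) := by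
                gcongr
                · exact hc0.le.trans hcH
                · exact hgH _
                · linarith
            _ = _ := by ring
      _ = (‖x‖ * H) * ∑ k ∈ Finset.range g.natDegree, (1 / 2 : ℝ) ^ k := by rw [Finset.mul_sum]
      _ ≤ (‖x‖ * H) * 2 := by
          have := sum_geometric_two_le g.natDegree
          have : 0 ≤ ‖x‖ * H := mul_nonneg (norm_nonneg _) (hc0.le.trans hcH)
          gcongr
      _ ≤ ‖c‖ / 2 := by linarith
  have h1 : ‖f.eval x‖ = ‖x‖ ^ μ * ‖g.eval x‖ := by
    conv_lhs => rw [hg]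
    rw [Polynomial.eval_mul, Polynomial.eval_pow, Polynomial.eval_X, norm_mul, norm_pow]
  have h2 : ‖c‖ / 2 ≤ ‖g.eval x‖ := by
    have := norm_sub_norm_le c (g.eval x)
    rw [norm_sub_rev] at this
    linarith
  have h3 : ‖g.eval x‖ ≤ 3 / 2 * ‖c‖ := by
    have := norm_sub_norm_le (g.eval x) c
    linarith
  have hpow : 0 ≤ ‖x‖ ^ μ := by positivity
  rw [h1]
  constructor <;> nlinarith

/-! ### Complex power series solutions and the maximum principle. -/

/-- The complex power series that converge absolutely at `t`. -/
def summableSubalgebra (t : ℂ) : Subalgebra ℂ (PowerSeries ℂ) where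
  carrier := {a | Summable fun k => ‖PowerSeries.coeff k a * t ^ k‖}
  mul_mem' := by
    intro a b ha hb
    refine (summable_norm_sum_mul_antidiagonal_of_summable_norm ha hb).congr fun k => ?_
    rw [PowerSeries.coeff_mul, Finset.sum_mul]
    congr 1
    refine Finset.sum_congr rfl fun p hp => ?_
    rw [← Finset.HasAntidiagonal.mem_antidiagonal.1 hp, pow_add]
    ring
  add_mem' := by
    intro a b ha hb
    refine Summable.of_nonneg_of_le (fun _ => norm_nonneg _) (fun k => ?_) (Summable.add ha hb)
    rw [map_add, add_mul]
    exact norm_add_le _ _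
  algebraMap_mem' := by
    intro r
    refine summable_of_ne_finset_zero (s := {0}) fun k hk => ?_
    have : k ≠ 0 := by simpa using hk
    simp [PowerSeries.coeff_C, this]

lemma mem_summableSubalgebra {t : ℂ} {a : PowerSeries ℂ} :
    a ∈ summableSubalgebra t ↔ Summable fun k => ‖PowerSeries.coeff k a * t ^ k‖ := Iff.rfl

lemma X_mem_summableSubalgebra (t : ℂ) : (PowerSeries.X : PowerSeries ℂ) ∈ summableSubalgebra t := by
  refine summable_of_ne_finset_zero (s := {1}) fun k hk => ?_
  have : k ≠ 1 := by simpa using hk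
  simp [PowerSeries.coeff_X, this]

/-- Evaluation at `t` of the complex power series that converge absolutely at `t`. -/
noncomputable def sumHom (t : ℂ) : summableSubalgebra t →ₐ[ℂ] ℂ :=
  AlgHom.ofLinearMap
    { toFun := fun a => ∑' k, PowerSeries.coeff k (a : PowerSeries ℂ) * t ^ k
      map_add' := fun a b => by
        have ha := (mem_summableSubalgebra.1 a.2).of_norm
        have hb := (mem_summableSubalgebra.1 b.2).of_norm
        rw [← ha.tsum_add hb]
        simp [add_mul]
      map_smul' := fun r a => by
        simp [mul_assoc, tsum_mul_left] }
    (by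
      simp only [LinearMap.coe_mk, AddHom.coe_mk, OneMemClass.coe_one]
      rw [tsum_eq_single 0 fun k hk => by simp [PowerSeries.coeff_one, hk]]
      simp)
    (fun a b => by
      simp only [LinearMap.coe_mk, AddHom.coe_mk, MulMemClass.coe_mul]
      rw [tsum_mul_tsum_eq_tsum_sum_antidiagonal_of_summable_norm a.2 b.2]
      refine tsum_congr fun k => ?_
      rw [PowerSeries.coeff_mul, Finset.sum_mul]
      refine Finset.sum_congr rfl fun p hp => ?_
      rw [← Finset.HasAntidiagonal.mem_antidiagonal.1 hp, pow_add]
      ring)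

lemma sumHom_apply (t : ℂ) (a : summableSubalgebra t) :
    sumHom t a = ∑' k, PowerSeries.coeff k (a : PowerSeries ℂ) * t ^ k := rfl

lemma sumHom_X (t : ℂ) : sumHom t ⟨PowerSeries.X, X_mem_summableSubalgebra t⟩ = t := by
  rw [sumHom_apply, tsum_eq_single 1 fun k hk => by simp [PowerSeries.coeff_X, hk]]
  simp

/-- A formal power series solution is an actual solution where it converges absolutely. -/
lemma sum_eval_eq_zero {f : ℕ → Polynomial ℂ} {n e κ : ℕ} {u : PowerSeries ℂ}
    (h : ∑ j ∈ Finset.range (n + 1), Polynomial.aeval (PowerSeries.X ^ e : PowerSeries ℂ) (f j)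
      * (PowerSeries.X ^ κ * u) ^ j = 0) {t : ℂ} (hu : u ∈ summableSubalgebra t) :
    ∑ j ∈ Finset.range (n + 1), (f j).eval (t ^ e) *
      (t ^ κ * ∑' k, PowerSeries.coeff k u * t ^ k) ^ j = 0 := by
  set X' : summableSubalgebra t := ⟨PowerSeries.X, X_mem_summableSubalgebra t⟩ with hX'
  -- The identity already holds in the subalgebra, where evaluation at t is a ring homomorphism.
  have h' : ∑ j ∈ Finset.range (n + 1), Polynomial.aeval (X' ^ e) (f j)
      * (X' ^ κ * ⟨u, hu⟩) ^ j = 0 := by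
    apply Subtype.val_injective
    change (summableSubalgebra t).val _ = 0
    rw [map_sum, ← h]
    refine Finset.sum_congr rfl fun j _ => ?_
    rw [map_mul, ← Polynomial.aeval_algHom_apply]
    rfl
  have := congrArg (sumHom t) h'
  rw [map_sum, map_zero] at this
  rw [← this]
  refine Finset.sum_congr rfl fun j _ => ?_
  rw [map_mul, map_pow, map_mul, map_pow, ← Polynomial.aeval_algHom_apply, map_pow, hX', sumHom_X,
    Polynomial.coe_aeval_eq_eval]
  rfl

lemma mem_summableSubalgebra_of_norm_lt {u : PowerSeries ℂ} {z γ : ℂ}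
    (hlim : Tendsto (fun N => ∑ k ∈ Finset.range N, PowerSeries.coeff k u * z ^ k) atTop (𝓝 γ))
    {t : ℂ} (ht : ‖t‖ < ‖z‖) : u ∈ summableSubalgebra t := by
  have := summable_powerSeries_of_norm_lt (f := fun k => PowerSeries.coeff k u) hlim.cauchySeq ht
  exact this.norm

/-- Around each t, the Weierstrass test applies on the disc of an intermediate radius s, where the
series converges absolutely. -/
lemma differentiableOn_tsum {u : PowerSeries ℂ} {z γ : ℂ}
    (hlim : Tendsto (fun N => ∑ k ∈ Finset.range N, PowerSeries.coeff k u * z ^ k) atTop (𝓝 γ)) :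
    DifferentiableOn ℂ (fun t => ∑' k, PowerSeries.coeff k u * t ^ k) (Metric.ball 0 ‖z‖) := by
  intro t ht
  rw [mem_ball_zero_iff] at ht
  obtain ⟨s, hts, hsz⟩ := exists_between ht
  have hs0 : 0 ≤ s := (norm_nonneg t).trans hts.le
  have hmem := mem_summableSubalgebra_of_norm_lt hlim (t := (s : ℂ))
    (by rwa [Complex.norm_real, Real.norm_of_nonneg hs0])
  have hd : DifferentiableOn ℂ (fun t => ∑' k, PowerSeries.coeff k u * t ^ k) (Metric.ball 0 s) := by
    refine Complex.differentiableOn_tsum_of_summable_norm hmem (fun k => ?_) Metric.isOpen_ball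
      fun k w hw => ?_
    · fun_prop
    · rw [mem_ball_zero_iff] at hw
      rw [norm_mul, norm_mul, norm_pow, norm_pow, Complex.norm_real, Real.norm_of_nonneg hs0]
      gcongr
  exact (hd.differentiableAt (Metric.isOpen_ball.mem_nhds (by simpa using hts))).differentiableWithinAt

/-- At a point of convergence close to the origin, the absolute value of the sum of a power series
solution is nearly that of its leading term. -/
lemma abs_log_norm_limit_sub_le {f : ℕ → Polynomial ℂ} {n e κ : ℕ} (hn : 1 ≤ n)
    {u : PowerSeries ℂ} (hu0 : PowerSeries.coeff 0 u ≠ 0)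
    (h : ∑ j ∈ Finset.range (n + 1), Polynomial.aeval (PowerSeries.X ^ e : PowerSeries ℂ) (f j)
      * (PowerSeries.X ^ κ * u) ^ j = 0) (h0 : f 0 ≠ 0) {H : ℝ}
    (hH : ∀ j k, ‖(f j).coeff k‖ ≤ H) {z γ : ℂ} (hz : z ≠ 0)
    (hsmall : ∀ j ≤ n, f j ≠ 0 → 4 * ‖z ^ e‖ * H ≤ ‖(f j).trailingCoeff‖)
    (hlim : Tendsto (fun N => ∑ k ∈ Finset.range N, PowerSeries.coeff k u * z ^ k) atTop (𝓝 γ)) :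
    γ ≠ 0 ∧ |Real.log ‖γ‖ - Real.log ‖PowerSeries.coeff 0 u‖| ≤ 2 * (n + 1) * Real.log (3 * n) := by
  set L : ℝ := 2 * (n + 1) * Real.log (3 * n) with hL
  set U : ℂ → ℂ := fun t => ∑' k, PowerSeries.coeff k u * t ^ k with hU
  have hz0 : 0 < ‖z‖ := norm_pos_iff.2 hz
  have hH0 : 0 ≤ H := (norm_nonneg _).trans (hH 0 0)
  have hUd : DifferentiableOn ℂ U (Metric.ball 0 ‖z‖) := differentiableOn_tsum hlim
  have hU0 : U 0 = PowerSeries.coeff 0 u := by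
    simp only [hU]
    rw [tsum_eq_single 0 fun k hk => by simp [hk]]
    simp
  have hbounds : ∀ t : ℂ, ‖t‖ < ‖z‖ → ∀ j ≤ n,
      ‖(f j).trailingCoeff‖ * ‖t ^ e‖ ^ (f j).natTrailingDegree / 2 ≤ ‖(f j).eval (t ^ e)‖ ∧
      ‖(f j).eval (t ^ e)‖ ≤
        3 / 2 * (‖(f j).trailingCoeff‖ * ‖t ^ e‖ ^ (f j).natTrailingDegree) := by
    intro t ht j hj
    refine norm_eval_bounds (hH j) fun hfj => le_trans ?_ (hsmall j hj hfj)
    rw [norm_pow, norm_pow]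
    gcongr
  have htc0 : 0 < ‖(f 0).trailingCoeff‖ :=
    norm_pos_iff.2 (Polynomial.trailingCoeff_nonzero_iff_nonzero.2 h0)
  have heq : ∀ t : ℂ, ‖t‖ < ‖z‖ → ∑ j ∈ Finset.range (n + 1), (f j).eval (t ^ e) *
      (t ^ κ * U t) ^ j = 0 := fun t ht =>
    sum_eval_eq_zero h (mem_summableSubalgebra_of_norm_lt hlim ht)
  -- A zero at t ≠ 0 would leave f_0(t^e) = 0 in the equation, against the lower bound for |f_0|; at
  -- t = 0 the value is the nonzero leading coefficient.
  have hUne : ∀ t : ℂ, ‖t‖ < ‖z‖ → U t ≠ 0 := by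
    intro t ht hUt
    rcases eq_or_ne t 0 with rfl | ht0
    · exact hu0 (hU0 ▸ hUt)
    · have h1 := heq t ht
      rw [Finset.sum_range_succ', hUt] at h1
      simp at h1
      have h2 := (hbounds t ht 0 (Nat.zero_le n)).1
      rw [h1, norm_zero] at h2
      have h3 : 0 < ‖t ^ e‖ := norm_pos_iff.2 (pow_ne_zero _ ht0)
      have : 0 < ‖(f 0).trailingCoeff‖ * ‖t ^ e‖ ^ (f 0).natTrailingDegree / 2 := by positivity
      linarith
  have hosc : ∀ s : ℝ, 0 < s → s < ‖z‖ → ∀ t t' : ℂ, ‖t‖ = s → ‖t'‖ = s →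
      Real.log ‖U t'‖ - Real.log ‖U t‖ ≤ L := by
    intro s hs hsz t t' ht ht'
    have hne : ∀ w : ℂ, ‖w‖ = s → w ≠ 0 := by
      rintro w hw rfl
      simp at hw
      linarith
    have hpre : IsPreconnected (Metric.sphere (0 : ℂ) s) :=
      isPreconnected_sphere (by simp) 0 s
    -- Applied to t^κ U(t); the factor |t|^κ is constant on the circle and cancels.
    have key := log_norm_sub_log_norm_le hpre hn
      (B := fun j => ‖(f j).trailingCoeff‖ * (s ^ e) ^ (f j).natTrailingDegree)
      (fun j => by positivity) (by positivity) (b := fun t j => (f j).eval (t ^ e))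
      (Y := fun t => t ^ κ * U t) (fun w hw j hj => by
        rw [mem_sphere_zero_iff_norm] at hw
        have := hbounds w (hw ▸ hsz) j hj
        rwa [norm_pow, hw] at this)
      (by
        refine ContinuousOn.mul (by fun_prop) (hUd.continuousOn.mono fun w hw => ?_)
        rw [mem_sphere_zero_iff_norm] at hw
        rw [mem_ball_zero_iff, hw]
        exact hsz)
      (fun w hw => by
        rw [mem_sphere_zero_iff_norm] at hw
        exact mul_ne_zero (pow_ne_zero _ (hne w hw)) (hUne w (hw ▸ hsz)))
      (fun w hw => by
        rw [mem_sphere_zero_iff_norm] at hw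
        exact heq w (hw ▸ hsz))
      (mem_sphere_zero_iff_norm.2 ht) (mem_sphere_zero_iff_norm.2 ht')
    simp only [norm_mul, norm_pow] at key
    rw [Real.log_mul, Real.log_mul, ht, ht'] at key
    · linarith
    · exact pow_ne_zero _ (norm_ne_zero_iff.2 (hne _ ht))
    · exact norm_ne_zero_iff.2 (hUne _ (ht ▸ hsz))
    · exact pow_ne_zero _ (norm_ne_zero_iff.2 (hne _ ht'))
    · exact norm_ne_zero_iff.2 (hUne _ (ht' ▸ hsz))
  have hmain : ∀ t : ℂ, t ≠ 0 → ‖t‖ < ‖z‖ →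
      ‖U t‖ * Real.exp (-L) ≤ ‖U 0‖ ∧ ‖U 0‖ ≤ ‖U t‖ * Real.exp L := by
    intro t ht0 ht
    have hs : 0 < ‖t‖ := norm_pos_iff.2 ht0
    have hUt : 0 < ‖U t‖ := norm_pos_iff.2 (hUne t ht)
    have hsub : Metric.closedBall (0 : ℂ) ‖t‖ ⊆ Metric.ball 0 ‖z‖ :=
      Metric.closedBall_subset_ball ht
    have h0mem : (0 : ℂ) ∈ closure (Metric.ball (0 : ℂ) ‖t‖) :=
      subset_closure (Metric.mem_ball_self hs)
    have hlog : ∀ t' : ℂ, ‖t'‖ = ‖t‖ → 0 < ‖U t'‖ := fun t' ht' =>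
      norm_pos_iff.2 (hUne t' (ht' ▸ ht))
    constructor
    -- The maximum principle for 1/U bounds |U(0)| from below.
    · have h1 : ‖(U 0)⁻¹‖ ≤ (‖U t‖ * Real.exp (-L))⁻¹ := by
        refine Complex.norm_le_of_forall_mem_frontier_norm_le (f := fun t => (U t)⁻¹)
          Metric.isBounded_ball
          ((hUd.inv fun w hw => hUne w (by simpa using hw)).diffContOnCl_ball hsub)
          (fun w hw => ?_) h0mem
        rw [frontier_ball _ hs.ne', mem_sphere_zero_iff_norm] at hw
        rw [norm_inv]
        refine inv_anti₀ (by positivity) ?_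
        have := hosc ‖t‖ hs ht w t hw rfl
        rw [← Real.exp_log (hlog w hw), ← Real.exp_log hUt, ← Real.exp_add, Real.exp_le_exp]
        linarith
      rw [norm_inv] at h1
      exact (inv_le_inv₀ (by rw [hU0]; exact norm_pos_iff.2 hu0) (by positivity)).1 h1
    · refine Complex.norm_le_of_forall_mem_frontier_norm_le (f := U)
        Metric.isBounded_ball (hUd.diffContOnCl_ball hsub) (fun w hw => ?_) h0mem
      rw [frontier_ball _ hs.ne', mem_sphere_zero_iff_norm] at hw
      have := hosc ‖t‖ hs ht t w rfl hw
      rw [← Real.exp_log (hlog w hw), ← Real.exp_log hUt, ← Real.exp_add, Real.exp_le_exp]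
      linarith
  -- The point z is on the boundary of the disc, where convergence may be only conditional, so the
  -- bounds are carried to it radially by Abel's theorem.
  have habel := Complex.tendsto_tsum_powerSeries_nhdsWithin_lt hlim
  rw [tendsto_map'_iff] at habel
  have hev : ∀ᶠ x : ℝ in 𝓝[<] 1, x ∈ Set.Ioo (0 : ℝ) 1 := Ioo_mem_nhdsLT zero_lt_one
  have hval : ∀ x : ℝ, (∑' k, PowerSeries.coeff k u * z ^ k * (x : ℂ) ^ k) = U (z * x) := fun x => by
    simp only [hU]
    refine tsum_congr fun k => ?_
    rw [mul_pow, mul_assoc]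
  have hmain' : ∀ x ∈ Set.Ioo (0 : ℝ) 1, ‖U (z * x)‖ * Real.exp (-L) ≤ ‖U 0‖ ∧
      ‖U 0‖ ≤ ‖U (z * x)‖ * Real.exp L := by
    intro x hx
    refine hmain _ (mul_ne_zero hz (by exact_mod_cast hx.1.ne')) ?_
    rw [norm_mul, Complex.norm_real, Real.norm_of_nonneg hx.1.le]
    exact mul_lt_of_lt_one_right hz0 hx.2
  have hlimU : Tendsto (fun x : ℝ => ‖U (z * x)‖) (𝓝[<] 1) (𝓝 ‖γ‖) := by
    refine (habel.norm).congr fun x => ?_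
    rw [Function.comp_apply, hval]
  have h1 : ‖γ‖ * Real.exp (-L) ≤ ‖U 0‖ :=
    le_of_tendsto (hlimU.mul_const _) (hev.mono fun x hx => (hmain' x hx).1)
  have h2 : ‖U 0‖ ≤ ‖γ‖ * Real.exp L :=
    ge_of_tendsto (hlimU.mul_const _) (hev.mono fun x hx => (hmain' x hx).2)
  rw [hU0] at h1 h2
  have hu0' : 0 < ‖PowerSeries.coeff 0 u‖ := norm_pos_iff.2 hu0
  have hγ : 0 < ‖γ‖ := by
    by_contra hγ
    have : ‖γ‖ = 0 := le_antisymm (not_lt.1 hγ) (norm_nonneg _)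
    rw [this, zero_mul] at h2
    linarith
  refine ⟨norm_pos_iff.1 hγ, abs_le.2 ⟨?_, ?_⟩⟩
  · have := Real.log_le_log hu0' h2
    rw [Real.log_mul hγ.ne' (Real.exp_ne_zero _), Real.log_exp] at this
    linarith
  · have := Real.log_le_log (by positivity) h1
    rw [Real.log_mul hγ.ne' (Real.exp_ne_zero _), Real.log_exp] at this
    linarith

end Archimedean

/-! ### Places, weights and the projective height. -/

section Height

variable {K : Type*} [Field K] [NumberField K]

/-- The absolute value attached to a place. -/
def Place.abv : Place K → AbsoluteValue K ℝ
  | Sum.inl v => v.1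
  | Sum.inr v => v.1

/-- The exponent of the absolute value of a place in the product formula. -/
noncomputable def Place.weight : Place K → ℕ
  | Sum.inl _ => 1
  | Sum.inr v => v.mult

/-- The exponent of the absolute value of an infinite place in the product formula, and `0` for a
finite place. -/
noncomputable def Place.archWeight : Place K → ℕ
  | Sum.inl _ => 0
  | Sum.inr v => v.mult

lemma normAbs_eq (v : Place K) (x : K) : normAbs v x = v.abv x ^ v.weight := by
  cases v with
  | inl v => exact (pow_one _).symm
  | inr v => rfl

lemma Place.weight_pos (v : Place K) : 0 < v.weight := by
  cases v with
  | inl v => exact zero_lt_one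
  | inr v => exact NumberField.InfinitePlace.mult_pos

lemma log_normAbs (v : Place K) (x : K) :
    Real.log (normAbs v x) = v.weight * Real.log (v.abv x) := by
  rw [normAbs_eq, Real.log_pow]

/-- The logarithmic excess at a place of the largest coordinate of a tuple over a given one. -/
noncomputable def gap {ι : Type*} (x : ι → K) (i : ι) (v : Place K) : ℝ :=
  v.weight * (Real.log (⨆ j, v.abv (x j)) - Real.log (v.abv (x i)))

/-- Dividing the tuple by x i preserves its height by the product formula and makes one coordinate
1. Every local factor is then at least 1, so discarding the places outside S can only lower the
product. -/
lemma sum_gap_le_logHeight {ι : Type*} [Finite ι] {x : ι → K} {i : ι} (hi : x i ≠ 0)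
    (S : Finset (Place K)) : ∑ v ∈ S, gap x i v ≤ Height.logHeight x := by
  classical
  set x' : ι → K := (x i)⁻¹ • x with hx'
  have hx'i : x' i = 1 := by simp [hx', hi]
  have hx'0 : x' ≠ 0 := fun h => by simp [h] at hx'i
  have : Nonempty ι := ⟨i⟩
  set M : Place K → ℝ := fun v => ⨆ j, v.abv (x' j) with hM
  have hM1 : ∀ v, 1 ≤ M v := fun v =>
    Finite.le_ciSup_of_le i (by rw [hx'i, map_one])
  have hgap : ∀ v, gap x i v = Real.log (M v ^ v.weight) := by
    intro v
    have h1 : M v = (v.abv (x i))⁻¹ * ⨆ j, v.abv (x j) := by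
      rw [Real.mul_iSup_of_nonneg (inv_nonneg.2 (v.abv.nonneg _))]
      simp [hM, hx']
    have h2 : 0 < ⨆ j, v.abv (x j) := (v.abv.pos hi).trans_le (Finite.le_ciSup_of_le i le_rfl)
    rw [gap, Real.log_pow, h1, Real.log_mul (inv_ne_zero (v.abv.pos hi).ne') h2.ne', Real.log_inv]
    ring
  have hfin : (Function.mulSupport fun v : NumberField.FinitePlace K => M (Sum.inl v)).Finite := by
    have hU : (⋃ j ∈ {j : ι | x' j ≠ 0},
        Function.mulSupport fun v : NumberField.FinitePlace K => v (x' j)).Finite :=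
      (Set.toFinite _).biUnion fun j hj => NumberField.FinitePlace.hasFiniteMulSupport hj
    refine hU.subset fun v hv => ?_
    by_contra hcon
    apply hv
    refine le_antisymm (ciSup_le fun j => ?_) (hM1 _)
    by_cases hj : x' j = 0
    · simp [hj]
    · have : v (x' j) = 1 := by
        by_contra h1
        exact hcon (Set.mem_biUnion (show j ∈ {j : ι | x' j ≠ 0} from hj) h1)
      exact this.le
  have hL : ∏ v ∈ S.toLeft, M (Sum.inl v) ≤ ∏ᶠ v : NumberField.FinitePlace K, M (Sum.inl v) := by
    rw [finprod_eq_prod_of_mulSupport_subset (s := S.toLeft ∪ hfin.toFinset) _ (by simp)]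
    exact Finset.prod_le_prod_of_subset_of_one_le Finset.subset_union_left
      (fun v _ => zero_le_one.trans (hM1 _)) fun v _ _ => hM1 _
  have hR : ∏ v ∈ S.toRight, M (Sum.inr v) ^ v.mult ≤
      ∏ v : NumberField.InfinitePlace K, M (Sum.inr v) ^ v.mult :=
    Finset.prod_le_prod_of_subset_of_one_le (Finset.subset_univ _)
      (fun v _ => zero_le_one.trans (one_le_pow₀ (hM1 _))) fun v _ _ => one_le_pow₀ (hM1 _)
  have hS : ∑ v ∈ S, gap x i v = Real.log ((∏ v ∈ S.toRight, M (Sum.inr v) ^ v.mult) *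
      ∏ v ∈ S.toLeft, M (Sum.inl v)) := by
    simp only [hgap]
    rw [← Real.log_prod fun v _ => pow_ne_zero _ (zero_lt_one.trans_le (hM1 v)).ne',
      Finset.prod_sum_eq_prod_toLeft_mul_prod_toRight, mul_comm]
    simp [Place.weight]
  have hpos : ∀ v, 0 < M v := fun v => zero_lt_one.trans_le (hM1 v)
  rw [hS, Height.logHeight_eq_log_mulHeight, ← Height.mulHeight_smul_eq_mulHeight x (inv_ne_zero hi),
    ← hx', NumberField.mulHeight_eq hx'0]
  refine Real.log_le_log (mul_pos (Finset.prod_pos fun v _ => pow_pos (hpos _) _)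
    (Finset.prod_pos fun v _ => hpos _)) ?_
  exact mul_le_mul hR hL (Finset.prod_nonneg fun v _ => (hpos _).le)
    (Finset.prod_nonneg fun v _ => (pow_pos (hpos (Sum.inr v)) _).le)

/-- The local degrees at infinity sum to d, so an error charged once per archimedean weight survives
division by d as a single constant. -/
lemma sum_archWeight_le (S : Finset (Place K)) :
    ∑ v ∈ S, (v.archWeight : ℝ) ≤ Module.finrank ℚ K := by
  classical
  rw [Finset.sum_sum_eq_sum_toLeft_add_sum_toRight]
  simp only [Place.archWeight, Nat.cast_zero, Finset.sum_const_zero, zero_add]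
  rw [← NumberField.InfinitePlace.sum_mult_eq]
  push_cast
  exact Finset.sum_le_sum_of_subset_of_nonneg (Finset.subset_univ _) fun _ _ _ => Nat.cast_nonneg _

lemma finite_setOf_normAbs_lt_one {α : K} (hα : α ≠ 0) : {v : Place K | normAbs v α < 1}.Finite := by
  have h1 : {v : NumberField.FinitePlace K | v α ≠ 1}.Finite :=
    NumberField.FinitePlace.hasFiniteMulSupport hα
  refine ((h1.image Sum.inl).union (Set.toFinite (Set.range Sum.inr))).subset fun v hv => ?_
  cases v with
  | inl v => exact Or.inl ⟨v, ne_of_lt hv, rfl⟩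
  | inr v => exact Or.inr ⟨v, rfl⟩

lemma toReal_localHeight (v : Place K) {x : K} (hx : x ≠ 0) :
    (localHeight v x).toReal =
      v.weight / (Module.finrank ℚ K : ℝ) * max (-Real.log (v.abv x)) 0 := by
  have hw : (0 : ℝ) ≤ v.weight := Nat.cast_nonneg _
  have h : -(min (Real.log (normAbs v x)) 0) = v.weight * max (-Real.log (v.abv x)) 0 := by
    rw [log_normAbs, mul_max_of_nonneg _ _ hw, mul_zero, mul_neg, ← max_neg_neg, neg_zero]
  rw [localHeight, if_neg hx, h, ENNReal.toReal_ofReal (by positivity)]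
  ring

lemma localHeight_ne_top (v : Place K) {x : K} (hx : x ≠ 0) : localHeight v x ≠ ⊤ := by
  rw [localHeight, if_neg hx]
  exact ENNReal.ofReal_ne_top

end Height

/-! ### The dichotomy at one place: far from or near to the origin. -/

section LocalEstimate

variable {K : Type*} [Field K]

/-- For n = 0 the edge polynomial would be the nonzero constant c_0. -/
lemma one_le_degree_of_edge {f : ℕ → Polynomial K} {n : ℕ} {a : K} (h0 : f 0 ≠ 0) {J : Finset ℕ}
    (hJ : J ⊆ Finset.range (n + 1)) (hJne : J.Nonempty)
    (h : ∑ j ∈ J, (f j).trailingCoeff * a ^ j = 0) : 1 ≤ n := by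
  by_contra hn
  have hn0 : n = 0 := by omega
  subst hn0
  have : J = {0} := by
    refine (Finset.subset_singleton_iff.1 (by simpa using hJ)).resolve_left hJne.ne_empty
  rw [this, Finset.sum_singleton, pow_zero, mul_one] at h
  exact h0 (Polynomial.trailingCoeff_eq_zero.1 h)

/-- The size of the leading coefficient of a power series solution in terms of the coefficients of
the equation. -/
lemma abs_log_leadingCoeff_le (v : AbsoluteValue K ℝ) {f : ℕ → Polynomial K} {n : ℕ} {N H : ℝ}
    (hN1 : 1 ≤ N)
    (hN : ∀ (s : Finset ℕ) (g : ℕ → K) (B : ℝ), s.card ≤ n → 0 ≤ B → (∀ i ∈ s, v (g i) ≤ B) →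
      v (∑ i ∈ s, g i) ≤ N * B)
    (hH : ∀ j k, v ((f j).coeff k) ≤ H) {a : K} (ha : a ≠ 0) {J : Finset ℕ}
    (hJ : J ⊆ Finset.range (n + 1)) (hJne : J.Nonempty) (hJ0 : ∀ j ∈ J, f j ≠ 0)
    (h : ∑ j ∈ J, (f j).trailingCoeff * a ^ j = 0) {S : ℝ}
    (hS : ∀ j ≤ n, f j ≠ 0 → Real.log H - Real.log (v (f j).trailingCoeff) ≤ S) :
    |Real.log (v a)| ≤ S + Real.log N := by
  have htc : ∀ j ∈ J, (f j).trailingCoeff ≠ 0 := fun j hj =>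
    Polynomial.trailingCoeff_nonzero_iff_nonzero.2 (hJ0 j hj)
  have hJn : ∀ j ∈ J, j ≤ n := fun j hj => Nat.lt_succ_iff.1 (Finset.mem_range.1 (hJ hj))
  obtain ⟨⟨i, hi, hi'⟩, ⟨j, hj, hj'⟩⟩ := exists_root_bounds v hN1 hN hJne
    (by simpa using Finset.card_le_card hJ) ha htc (fun j _ => hH j _) h
  have hva := v.pos ha
  have hH0 : 0 < H := (v.pos (htc i hi)).trans_le (hH i _)
  have hN0 : 0 < N := zero_lt_one.trans_le hN1
  have h1 := Real.log_le_log (mul_pos hva (v.pos (htc i hi))) hi'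
  have h2 := Real.log_le_log (v.pos (htc j hj)) hj'
  rw [Real.log_mul hva.ne' (v.pos (htc i hi)).ne', Real.log_mul hN0.ne' hH0.ne'] at h1
  rw [Real.log_mul (mul_pos hN0 hH0).ne' hva.ne', Real.log_mul hN0.ne' hH0.ne'] at h2
  have h3 := hS i (hJn i hi) (hJ0 i hi)
  have h4 := hS j (hJn j hj) (hJ0 j hj)
  exact abs_le.2 ⟨by linarith, by linarith⟩

end LocalEstimate

section LocalEstimate

variable {K : Type*} [Field K]

/-- Either the trailing term of f_0 fails to dominate at ξ^e, which bounds -log|ξ^e|, or |β| equals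
the size of the leading term. In the second case the first absolute value vanishes and the root
bound, with N = 1, handles the other. -/
lemma finite_place_estimate {v : AbsoluteValue K ℝ} (hv : IsNonarchimedean v)
    {f : ℕ → Polynomial K} {n e κ : ℕ} (he : 0 < e) {y : PowerSeries K} (hκ : y.order = κ)
    (h : ∑ j ∈ Finset.range (n + 1), Polynomial.aeval (PowerSeries.X ^ e : PowerSeries K) (f j)
      * y ^ j = 0) (h0 : f 0 ≠ 0) {H : ℝ} (hH : ∀ j k, v ((f j).coeff k) ≤ H) {ξ β : K} (hξ : ξ ≠ 0)
    (hlim : Tendsto (fun N => v ((∑ k ∈ Finset.range N, PowerSeries.coeff k y * ξ ^ k) - β))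
      atTop (𝓝 0)) {S : ℝ}
    (hS : ∀ j ≤ n, f j ≠ 0 → Real.log H - Real.log (v (f j).trailingCoeff) ≤ S) :
    -Real.log (v (ξ ^ e)) ≤ S ∨ (β ≠ 0 ∧
      |Real.log (v β) - (Real.log (v (PowerSeries.coeff κ y)) + κ * Real.log (v ξ))|
        + |Real.log (v (PowerSeries.coeff κ y))| ≤ S) := by
  have hvξ : 0 < v (ξ ^ e) := v.pos (pow_ne_zero _ hξ)
  have htc : 0 < v (f 0).trailingCoeff :=
    v.pos (Polynomial.trailingCoeff_nonzero_iff_nonzero.2 h0)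
  have hH0 : 0 < H := htc.trans_le (hH 0 _)
  rcases le_or_gt (v (f 0).trailingCoeff) (v (ξ ^ e) * H) with h1 | h1
  · left
    have h2 := Real.log_le_log htc h1
    rw [Real.log_mul hvξ.ne' hH0.ne'] at h2
    have := hS 0 (Nat.zero_le n) h0
    linarith
  · right
    have ha : PowerSeries.coeff κ y ≠ 0 := (PowerSeries.order_eq_nat.1 hκ).1
    have hval := apply_eq_of_isNonarchimedean hv he hκ h h0 (hH 0) hξ h1 hlim
    have hpos : 0 < v β := by
      rw [hval]
      exact mul_pos (v.pos ha) (pow_pos (v.pos hξ) _)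
    refine ⟨v.pos_iff.1 hpos, ?_⟩
    obtain ⟨J, hJ, hJne, hJ0, hJs⟩ := exists_edge_sum_eq_zero f n e κ he y hκ h ⟨0, Nat.zero_le n, h0⟩
    have key := abs_log_leadingCoeff_le v (n := n) le_rfl (fun s g B _ hB hg => by
      rw [one_mul]
      exact sum_le_of_isNonarchimedean hv s g hB hg) hH ha hJ hJne hJ0 hJs hS
    rw [hval, Real.log_mul (v.pos ha).ne' (pow_pos (v.pos hξ) _).ne', Real.log_pow, sub_self,
      abs_zero, zero_add]
    simpa using key

lemma map_aeval_X_pow {L : Type*} [Field L] (φ : K →+* L) (f : Polynomial K) (e : ℕ) :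
    PowerSeries.map φ (Polynomial.aeval (PowerSeries.X ^ e : PowerSeries K) f) =
      Polynomial.aeval (PowerSeries.X ^ e : PowerSeries L) (f.map φ) := by
  rw [Polynomial.aeval_def, Polynomial.aeval_def, Polynomial.hom_eval₂, Polynomial.eval₂_map]
  congr 1
  · ext x
    simp
  · simp

lemma natTrailingDegree_map {L : Type*} [Field L] (φ : K →+* L) (f : Polynomial K) :
    (f.map φ).natTrailingDegree = f.natTrailingDegree := by
  rcases eq_or_ne f 0 with rfl | hf
  · simp
  refine le_antisymm ?_ ?_
  · refine Polynomial.natTrailingDegree_le_of_ne_zero ?_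
    rw [Polynomial.coeff_map]
    exact (map_ne_zero φ).2 (Polynomial.trailingCoeff_nonzero_iff_nonzero.2 hf)
  · refine Polynomial.le_natTrailingDegree ((Polynomial.map_ne_zero_iff φ.injective).2 hf)
      fun k hk => ?_
    rw [Polynomial.coeff_map, Polynomial.coeff_eq_zero_of_lt_natTrailingDegree hk, map_zero]

lemma trailingCoeff_map {L : Type*} [Field L] (φ : K →+* L) (f : Polynomial K) :
    (f.map φ).trailingCoeff = φ f.trailingCoeff := by
  rw [Polynomial.trailingCoeff, natTrailingDegree_map, Polynomial.coeff_map]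
  rfl

/-- The same dichotomy after embedding into ℂ, now with all f_j required to be dominated by their
trailing terms. The constant absorbs the oscillation 2(n+1) log(3n), the log n of the root bound,
and log 4 from the smallness threshold. -/
lemma infinite_place_estimate {v : AbsoluteValue K ℝ} {φ : K →+* ℂ} (hφ : ∀ x, v x = ‖φ x‖)
    {f : ℕ → Polynomial K} {n e κ : ℕ} (he : 0 < e) {y : PowerSeries K} (hκ : y.order = κ)
    (h : ∑ j ∈ Finset.range (n + 1), Polynomial.aeval (PowerSeries.X ^ e : PowerSeries K) (f j)
      * y ^ j = 0) (h0 : f 0 ≠ 0) {H : ℝ} (hH : ∀ j k, v ((f j).coeff k) ≤ H) {ξ β : K} (hξ : ξ ≠ 0)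
    (hlim : Tendsto (fun N => v ((∑ k ∈ Finset.range N, PowerSeries.coeff k y * ξ ^ k) - β))
      atTop (𝓝 0)) {S : ℝ}
    (hS : ∀ j ≤ n, f j ≠ 0 → Real.log H - Real.log (v (f j).trailingCoeff) ≤ S) :
    -Real.log (v (ξ ^ e)) ≤ S + (10 * n + 6 * n * Real.log n) ∨ (β ≠ 0 ∧
      |Real.log (v β) - (Real.log (v (PowerSeries.coeff κ y)) + κ * Real.log (v ξ))|
        + |Real.log (v (PowerSeries.coeff κ y))| ≤ S + (10 * n + 6 * n * Real.log n)) := by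
  obtain ⟨J, hJ, hJne, hJ0, hJs⟩ := exists_edge_sum_eq_zero f n e κ he y hκ h ⟨0, Nat.zero_le n, h0⟩
  have hn : 1 ≤ n := one_le_degree_of_edge h0 hJ hJne hJs
  have hn' : (1 : ℝ) ≤ n := by exact_mod_cast hn
  have hlogn : 0 ≤ Real.log n := Real.log_nonneg hn'
  have hvξ : 0 < v (ξ ^ e) := v.pos (pow_ne_zero _ hξ)
  have htc : ∀ j, f j ≠ 0 → 0 < v (f j).trailingCoeff := fun j hj =>
    v.pos (Polynomial.trailingCoeff_nonzero_iff_nonzero.2 hj)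
  have hH0 : 0 < H := (htc 0 h0).trans_le (hH 0 _)
  by_cases hsmall : ∀ j ≤ n, f j ≠ 0 → 4 * v (ξ ^ e) * H ≤ v (f j).trailingCoeff
  · right
    have ha : PowerSeries.coeff κ y ≠ 0 := (PowerSeries.order_eq_nat.1 hκ).1
    obtain ⟨u, hu⟩ : PowerSeries.X ^ κ ∣ y :=
      PowerSeries.X_pow_dvd_iff.2 fun d hd =>
        PowerSeries.coeff_of_lt_order d (by rw [hκ]; exact_mod_cast hd)
    have hcoeff : ∀ k, PowerSeries.coeff k u = PowerSeries.coeff (k + κ) y := fun k => by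
      rw [hu, PowerSeries.coeff_X_pow_mul]
    have hz : φ ξ ≠ 0 := (map_ne_zero φ).2 hξ
    have hlim' : Tendsto (fun N => ∑ k ∈ Finset.range N,
        PowerSeries.coeff k (PowerSeries.map φ u) * φ ξ ^ k) atTop (𝓝 (φ β / φ ξ ^ κ)) := by
      have h1 : Tendsto (fun N => φ (∑ k ∈ Finset.range N, PowerSeries.coeff k y * ξ ^ k)) atTop
          (𝓝 (φ β)) := by
        rw [tendsto_iff_norm_sub_tendsto_zero]
        simpa only [hφ, map_sub] using hlim
      -- Partial sums of u = y/t^κ are those of y shifted by κ, whose first κ terms vanish, divided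
      -- by ξ^κ.
      refine ((h1.comp (tendsto_add_atTop_nat κ)).div_const (φ ξ ^ κ)).congr fun N => ?_
      rw [Function.comp_apply, add_comm N κ, Finset.sum_range_add,
        Finset.sum_eq_zero (s := Finset.range κ) fun k hk => by
          rw [PowerSeries.coeff_of_lt_order k
            (by rw [hκ]; exact_mod_cast Finset.mem_range.1 hk), zero_mul],
        zero_add, map_sum, Finset.sum_div]
      refine Finset.sum_congr rfl fun k _ => ?_
      rw [PowerSeries.coeff_map, hcoeff, map_mul, map_pow, add_comm κ k, pow_add,
        div_eq_iff (pow_ne_zero _ hz), mul_assoc]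
    have heq : ∑ j ∈ Finset.range (n + 1),
        Polynomial.aeval (PowerSeries.X ^ e : PowerSeries ℂ) ((f j).map φ)
          * (PowerSeries.X ^ κ * PowerSeries.map φ u) ^ j = 0 := by
      have := congrArg (PowerSeries.map φ) h
      rw [map_sum, map_zero] at this
      rw [← this]
      refine Finset.sum_congr rfl fun j _ => ?_
      rw [map_mul, map_aeval_X_pow, map_pow]
      conv_rhs => rw [hu, map_mul, map_pow, PowerSeries.map_X]
    have hu0 : PowerSeries.coeff 0 (PowerSeries.map φ u) = φ (PowerSeries.coeff κ y) := by
      rw [PowerSeries.coeff_map, hcoeff, zero_add]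
    obtain ⟨hγ, hlog⟩ := abs_log_norm_limit_sub_le (f := fun j => (f j).map φ) hn
      (by rw [hu0]; exact (map_ne_zero φ).2 ha) heq
      ((Polynomial.map_ne_zero_iff φ.injective).2 h0)
      (fun j k => by rw [Polynomial.coeff_map, ← hφ]; exact hH j k) hz
      (fun j hj hfj => by
        rw [trailingCoeff_map, ← map_pow, ← hφ, ← hφ]
        exact hsmall j hj fun h => hfj (by rw [h, Polynomial.map_zero]))
      hlim'
    have hβ : β ≠ 0 := by
      rintro rfl
      simp at hγ
    refine ⟨hβ, ?_⟩
    rw [hu0, norm_div, norm_pow, ← hφ, ← hφ, ← hφ, Real.log_div (v.pos hβ).ne'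
      (pow_pos (v.pos hξ) _).ne', Real.log_pow] at hlog
    have key := abs_log_leadingCoeff_le v (n := n) (N := n) hn' (fun s g B hs hB hg => by
      calc v (∑ i ∈ s, g i) ≤ ∑ i ∈ s, v (g i) := v.sum_le _ _
        _ ≤ ∑ i ∈ s, B := Finset.sum_le_sum hg
        _ = s.card * B := by rw [Finset.sum_const, nsmul_eq_mul]
        _ ≤ n * B := by gcongr) hH ha hJ hJne hJ0 hJs hS
    have h3 : Real.log (3 * n) ≤ 2 + Real.log n := by
      rw [Real.log_mul (by norm_num) (by linarith)]
      have := Real.log_le_sub_one_of_pos (show (0 : ℝ) < 3 by norm_num)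
      linarith
    have h4 : 2 * ((n : ℝ) + 1) * Real.log (3 * n) ≤ 2 * ((n : ℝ) + 1) * (2 + Real.log n) := by
      gcongr
    have h5 : Real.log (v β) - (Real.log (v (PowerSeries.coeff κ y)) + κ * Real.log (v ξ)) =
        Real.log (v β) - κ * Real.log (v ξ) - Real.log (v (PowerSeries.coeff κ y)) := by ring
    rw [h5]
    nlinarith
  · left
    push Not at hsmall
    obtain ⟨j, hj, hfj, hlt⟩ := hsmall
    have h2 := Real.log_le_log (htc j hfj) hlt.le
    rw [Real.log_mul (by positivity) hH0.ne', Real.log_mul (by norm_num) hvξ.ne'] at h2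
    have h3 := Real.log_le_sub_one_of_pos (show (0 : ℝ) < 4 by norm_num)
    have h4 := hS j hj hfj
    have h5 : 0 ≤ 6 * n * Real.log n := by positivity
    linarith

/-- Since x = max x 0, both terms are values of the 1-Lipschitz map t ↦ min A (max t 0). -/
lemma abs_min_sub_le {A B x : ℝ} (hx : 0 ≤ x) : |min A (max B 0) - min x A| ≤ |B - x| := by
  have h1 := neg_abs_le (B - x)
  have h2 := le_abs_self (B - x)
  have h3 := abs_nonneg (B - x)
  rw [abs_le]
  rcases min_cases A (max B 0) with h | h <;> rcases min_cases x A with h' | h' <;>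
    rcases max_cases B 0 with h'' | h'' <;> constructor <;> linarith

end LocalEstimate

/-! ### From local estimates to the sum over places. -/

section PlaceEstimate

variable {K : Type*} [Field K] [NumberField K]

lemma ConvergesAt.tendsto_abv {v : Place K} {y : PowerSeries K} {ξ β : K}
    (h : ConvergesAt v y ξ β) :
    Tendsto (fun N => v.abv ((∑ k ∈ Finset.range N, PowerSeries.coeff k y * ξ ^ k) - β))
      atTop (𝓝 0) := by
  have hw : (v.weight : ℝ)⁻¹ ≠ 0 := inv_ne_zero (Nat.cast_ne_zero.2 v.weight_pos.ne')
  have h1 := Tendsto.rpow_const (p := (v.weight : ℝ)⁻¹) h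
    (Or.inr (inv_nonneg.2 (Nat.cast_nonneg _)))
  rw [Real.zero_rpow hw] at h1
  refine h1.congr fun N => ?_
  rw [normAbs_eq, Real.pow_rpow_inv_natCast (v.abv.nonneg _) v.weight_pos.ne']

/-- Weighting by local degrees unites both kinds of place: `archWeight` is 0 at finite ones, which
removes the archimedean constant. -/
lemma place_estimate (v : Place K) {f : ℕ → Polynomial K} {n e κ : ℕ} (he : 0 < e)
    {y : PowerSeries K} (hκ : y.order = κ)
    (h : ∑ j ∈ Finset.range (n + 1), Polynomial.aeval (PowerSeries.X ^ e : PowerSeries K) (f j)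
      * y ^ j = 0) (h0 : f 0 ≠ 0) {H : ℝ} (hH : ∀ j k, v.abv ((f j).coeff k) ≤ H) {ξ β : K}
    (hξ : ξ ≠ 0) (hconv : ConvergesAt v y ξ β) {S : ℝ}
    (hS : ∀ j ≤ n, f j ≠ 0 → Real.log H - Real.log (v.abv (f j).trailingCoeff) ≤ S) :
    v.weight * -Real.log (v.abv (ξ ^ e)) ≤
      v.weight * S + v.archWeight * (10 * n + 6 * n * Real.log n) ∨
    (β ≠ 0 ∧ v.weight * (|Real.log (v.abv β) - (Real.log (v.abv (PowerSeries.coeff κ y))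
        + κ * Real.log (v.abv ξ))| + |Real.log (v.abv (PowerSeries.coeff κ y))|) ≤
      v.weight * S + v.archWeight * (10 * n + 6 * n * Real.log n)) := by
  have hlim := hconv.tendsto_abv
  cases v with
  | inl v =>
    have hna : IsNonarchimedean (Place.abv (Sum.inl v : Place K)) := fun a b =>
      NumberField.FinitePlace.add_le v a b
    have := finite_place_estimate hna he hκ h h0 hH hξ hlim hS
    simpa [Place.weight, Place.archWeight] using this
  | inr v =>
    have hφ : ∀ x, Place.abv (Sum.inr v : Place K) x = ‖v.embedding x‖ := fun x =>
      (NumberField.InfinitePlace.norm_embedding_eq v x).symm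
    have hw : (0 : ℝ) ≤ (v.mult : ℝ) := Nat.cast_nonneg _
    simp only [Place.weight, Place.archWeight, ← mul_add]
    exact (infinite_place_estimate hφ he hκ h h0 hH hξ hlim hS).imp
      (fun h => mul_le_mul_of_nonneg_left h hw)
      fun h => ⟨h.1, mul_le_mul_of_nonneg_left h.2 hw⟩

/-- The local form of the gcd estimate. -/
lemma abs_min_localHeight_sub_le (v : Place K) {e κ : ℕ} (he : 0 < e) {ξ β a : K} (hξ : ξ ≠ 0)
    (hα : normAbs v (ξ ^ e) < 1) {R : ℝ}
    (h : v.weight * -Real.log (v.abv (ξ ^ e)) ≤ R ∨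
      (β ≠ 0 ∧ v.weight * (|Real.log (v.abv β) - (Real.log (v.abv a) + κ * Real.log (v.abv ξ))|
        + |Real.log (v.abv a)|) ≤ R)) :
    |(min (localHeight v (ξ ^ e)) (localHeight v β)).toReal
      - min ((κ : ℝ) / e) 1 * (localHeight v (ξ ^ e)).toReal| ≤ R / Module.finrank ℚ K := by
  have hξe : ξ ^ e ≠ 0 := pow_ne_zero _ hξ
  have he' : (0 : ℝ) < e := by exact_mod_cast he
  have hd : (0 : ℝ) < Module.finrank ℚ K := by exact_mod_cast Module.finrank_pos
  set d : ℝ := ((Module.finrank ℚ K : ℕ) : ℝ)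
  have hα' : v.abv (ξ ^ e) < 1 := by
    rw [normAbs_eq] at hα
    by_contra hle
    exact absurd (one_le_pow₀ (not_lt.1 hle)) (not_le.2 hα)
  set A := -Real.log (v.abv (ξ ^ e)) with hA
  have hA0 : 0 ≤ A := by
    have := Real.log_nonpos (v.abv.nonneg _) hα'.le
    linarith
  have hAξ : A = -(e * Real.log (v.abv ξ)) := by
    rw [hA, map_pow, Real.log_pow]
  have hhα : (localHeight v (ξ ^ e)).toReal = v.weight / d * A := by
    rw [toReal_localHeight v hξe, max_eq_left hA0]
  have hw : (0 : ℝ) ≤ v.weight / d := by positivity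
  have hc0 : 0 ≤ min ((κ : ℝ) / e) 1 := le_min (by positivity) zero_le_one
  have hc1 : min ((κ : ℝ) / e) 1 ≤ 1 := min_le_right _ _
  -- In the first case both quantities lie between 0 and h_v(ξ^e), whether or not β = 0. In the
  -- second, min(κ/e, 1) A = min(κA/e, A) and κA/e = -κ log|ξ|, so truncation being 1-Lipschitz
  -- leaves only the error in log|β|.
  rcases h with h | ⟨hβ, h⟩
  · have h1 : (min (localHeight v (ξ ^ e)) (localHeight v β)).toReal ≤ v.weight / d * A := by
      rw [← hhα]
      exact ENNReal.toReal_mono (localHeight_ne_top v hξe) (min_le_left _ _)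
    have h2 : 0 ≤ (min (localHeight v (ξ ^ e)) (localHeight v β)).toReal := ENNReal.toReal_nonneg
    have h3 : v.weight / d * A ≤ R / d := by
      rw [div_mul_eq_mul_div]
      gcongr
    have h4 : 0 ≤ v.weight / d * A := mul_nonneg hw hA0
    rw [hhα, abs_le]
    constructor <;> nlinarith
  · rw [ENNReal.toReal_min (localHeight_ne_top v hξe) (localHeight_ne_top v hβ), hhα,
      toReal_localHeight v hβ, ← mul_min_of_nonneg _ _ hw, mul_left_comm, ← mul_sub, abs_mul,
      abs_of_nonneg hw, min_mul_of_nonneg _ _ hA0, one_mul]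
    have h1 : |min A (max (-Real.log (v.abv β)) 0) - min ((κ : ℝ) / e * A) A| ≤
        |-Real.log (v.abv β) - κ / e * A| := abs_min_sub_le (by positivity)
    have h2 : (κ : ℝ) / e * A = -(κ * Real.log (v.abv ξ)) := by
      rw [hAξ]
      field_simp
    have h3 : |-Real.log (v.abv β) - κ / e * A| ≤
        |Real.log (v.abv β) - (Real.log (v.abv a) + κ * Real.log (v.abv ξ))|
          + |Real.log (v.abv a)| := by
      rw [h2, ← abs_neg]
      refine le_trans (le_of_eq ?_) (abs_add_le _ _)
      congr 1
      ring
    calc v.weight / d * |min A (max (-Real.log (v.abv β)) 0) - min ((κ : ℝ) / e * A) A|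
        ≤ v.weight / d *
          (|Real.log (v.abv β) - (Real.log (v.abv a) + κ * Real.log (v.abv ξ))|
            + |Real.log (v.abv a)|) := by
          gcongr
          exact h1.trans h3
      _ ≤ R / d := by
          rw [div_mul_eq_mul_div]
          gcongr

/-- At the origin all partial sums vanish, including the term with 0 ^ 0 = 1, so they cannot tend to
β ≠ 0. -/
lemma convSet_zero_eq_empty {y : PowerSeries K} (hy : PowerSeries.constantCoeff y = 0) {α β : K}
    (hβ : β ≠ 0) : convSet y α 0 β = ∅ := by
  refine Set.eq_empty_iff_forall_notMem.2 fun v hv => ?_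
  have h1 := hv.2.tendsto_abv
  have h2 : Tendsto (fun N => v.abv ((∑ k ∈ Finset.range N, PowerSeries.coeff k y * (0 : K) ^ k) - β))
      atTop (𝓝 (v.abv β)) := by
    refine tendsto_const_nhds.congr fun N => ?_
    rw [Finset.sum_eq_zero, zero_sub, v.abv.map_neg]
    intro k _
    rcases Nat.eq_zero_or_pos k with rfl | hk
    · rw [PowerSeries.coeff_zero_eq_constantCoeff_apply, hy, zero_mul]
    · rw [zero_pow hk.ne', mul_zero]
  exact (v.abv.pos hβ).ne' (tendsto_nhds_unique h2 h1)

/-- The gcd estimate with a sharper bound, in the case of a nonzero point. -/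
lemma abs_lgcdOn_sub_le {F : MvPolynomial (Fin 2) K} {n e κ : ℕ} (hn : n = F.degreeOf 1)
    {ξ β : K} (hξ : ξ ≠ 0) (he : 0 < e) {y : PowerSeries K}
    (hFy : MvPolynomial.aeval ![(PowerSeries.X : PowerSeries K) ^ e, y] F = 0)
    (hκ : y.order = κ) (h0 : yCoeff F 0 ≠ 0) (hfin : (convSet y (ξ ^ e) ξ β).Finite) :
    |lgcdOn (convSet y (ξ ^ e) ξ β) (ξ ^ e) β
      - min ((κ : ℝ) / e) 1 * heightOn (convSet y (ξ ^ e) ξ β) (ξ ^ e)| ≤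
      (n + 1) * projHeight F + (10 * n + 6 * n * Real.log n) := by
  classical
  have hd : (0 : ℝ) < Module.finrank ℚ K := by exact_mod_cast Module.finrank_pos
  have heq := hFy
  rw [aeval_eq_sum_yCoeff, ← hn] at heq
  set x : F.support → K := fun s => F.coeff s.1 with hx
  have hmem : ∀ j, yCoeff F j ≠ 0 → ∃ s : F.support, x s = (yCoeff F j).trailingCoeff := by
    intro j hj
    have h1 := Polynomial.trailingCoeff_nonzero_iff_nonzero.2 hj
    have h2 : (yCoeff F j).trailingCoeff = _ := coeff_yCoeff F j (yCoeff F j).natTrailingDegree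
    rw [h2] at h1 ⊢
    exact ⟨⟨_, MvPolynomial.mem_support_iff.2 h1⟩, rfl⟩
  have : Nonempty F.support := ⟨(hmem 0 h0).choose⟩
  choose! idx hidx using hmem
  set s := (Finset.range (n + 1)).filter fun j => yCoeff F j ≠ 0 with hs
  have hxne : ∀ j ∈ s, x (idx j) ≠ 0 := by
    intro j hj
    rw [hidx j (Finset.mem_filter.1 hj).2]
    exact Polynomial.trailingCoeff_nonzero_iff_nonzero.2 (Finset.mem_filter.1 hj).2
  set C : ℝ := 10 * n + 6 * n * Real.log n with hC
  have hC0 : 0 ≤ C := by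
    have := Real.log_natCast_nonneg n
    positivity
  -- S is the sum of the gaps over j, not their maximum, so that the sums over j and v can be
  -- interchanged; each of the at most n + 1 indices then costs one height.
  have hlocal : ∀ v ∈ convSet y (ξ ^ e) ξ β,
      |(min (localHeight v (ξ ^ e)) (localHeight v β)).toReal
        - min ((κ : ℝ) / e) 1 * (localHeight v (ξ ^ e)).toReal| ≤
      (∑ j ∈ s, gap x (idx j) v + v.archWeight * C) / Module.finrank ℚ K := by
    intro v hv
    refine abs_min_localHeight_sub_le v he (a := PowerSeries.coeff κ y) hξ hv.1 ?_
    have hgap : ∑ j ∈ s, gap x (idx j) v = v.weight * ∑ j ∈ s,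
        (Real.log (⨆ i, v.abv (x i)) - Real.log (v.abv (x (idx j)))) := by
      rw [Finset.mul_sum]
      rfl
    rw [hgap]
    refine place_estimate v he hκ heq h0 (H := ⨆ i, v.abv (x i)) (fun j k => ?_) hξ hv.2 fun j hj hj0 => ?_
    · rw [coeff_yCoeff]
      by_cases hc : F.coeff (Finsupp.single 0 k + Finsupp.single 1 j) = 0
      · rw [hc, map_zero]
        exact Real.iSup_nonneg fun i => v.abv.nonneg _
      · exact Finite.le_ciSup_of_le
          (⟨_, MvPolynomial.mem_support_iff.2 hc⟩ : F.support) le_rfl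
    · have hjs : j ∈ s := Finset.mem_filter.2 ⟨Finset.mem_range.2 (Nat.lt_succ_iff.2 hj), hj0⟩
      rw [← hidx j hj0]
      refine Finset.single_le_sum
        (f := fun j => Real.log (⨆ i, v.abv (x i)) - Real.log (v.abv (x (idx j))))
        (fun i hi => sub_nonneg.2 (Real.log_le_log (v.abv.pos (hxne i hi)) ?_)) hjs
      exact Finite.le_ciSup_of_le (idx i) le_rfl
  have hcard : (s.card : ℝ) ≤ n + 1 := by
    have := Finset.card_filter_le (Finset.range (n + 1)) fun j => yCoeff F j ≠ 0
    rw [Finset.card_range] at this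
    exact_mod_cast this
  rw [lgcdOn, heightOn, finsum_mem_eq_finite_toFinset_sum _ hfin,
    finsum_mem_eq_finite_toFinset_sum _ hfin, Finset.mul_sum, ← Finset.sum_sub_distrib]
  calc _ ≤ ∑ v ∈ hfin.toFinset, |(min (localHeight v (ξ ^ e)) (localHeight v β)).toReal
        - min ((κ : ℝ) / e) 1 * (localHeight v (ξ ^ e)).toReal| := Finset.abs_sum_le_sum_abs _ _
    _ ≤ ∑ v ∈ hfin.toFinset,
        (∑ j ∈ s, gap x (idx j) v + v.archWeight * C) / Module.finrank ℚ K :=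
      Finset.sum_le_sum fun v hv => hlocal v (hfin.mem_toFinset.1 hv)
    _ = (∑ j ∈ s, ∑ v ∈ hfin.toFinset, gap x (idx j) v
        + (∑ v ∈ hfin.toFinset, (v.archWeight : ℝ)) * C) / Module.finrank ℚ K := by
      rw [← Finset.sum_div, Finset.sum_add_distrib, Finset.sum_comm, Finset.sum_mul]
    _ ≤ (∑ j ∈ s, Height.logHeight x + Module.finrank ℚ K * C) / Module.finrank ℚ K := by
      gcongr with j hj
      · exact sum_gap_le_logHeight (hxne j hj) _
      · exact sum_archWeight_le _
    _ ≤ ((n + 1) * Height.logHeight x + Module.finrank ℚ K * C) / Module.finrank ℚ K := by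
      rw [Finset.sum_const, nsmul_eq_mul]
      have := Height.logHeight_nonneg x
      gcongr
    _ = (n + 1) * projHeight F + C := by
      rw [projHeight, ← hx]
      field_simp

end PlaceEstimate

end LocalGcd

/-! ### The proposition: degenerate cases and numerical constants. -/

/-- The variable with index `0` is `X`, the one with index `1` is `Y`. The power series
`y = ∑ a_k t ^ k` stands for `y(x) = ∑ a_k x ^ (k / e)`, with `x = t ^ e`, and `ξ` is the fixed
`e`-th root of `α`. -/
theorem proposition5p1 {K : Type*} [Field K] [NumberField K]
    (F : MvPolynomial (Fin 2) K) (hF : LocalGcd.AbsolutelyIrreducible F)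
    (m n : ℕ) (hm : m = F.degreeOf 0) (hn : n = F.degreeOf 1)
    (α β : K) (hαβ : α ≠ 0 ∨ β ≠ 0) (hroot : MvPolynomial.eval ![α, β] F = 0)
    (e : ℕ) (he : 0 < e) (ξ : K) (hξ : ξ ^ e = α)
    (y : PowerSeries K) (hy : PowerSeries.constantCoeff y = 0)
    (hFy : MvPolynomial.aeval ![(PowerSeries.X : PowerSeries K) ^ e, y] F = 0)
    (κ : ℕ) (hκ : y.order = (κ : ℕ∞))
    (T : Set (LocalGcd.Place K)) (hT : T = LocalGcd.convSet y α ξ β) :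
    T.Finite ∧
    |LocalGcd.lgcdOn T α β - min ((κ : ℝ) / (e : ℝ)) 1 * LocalGcd.heightOn T α| ≤
      30 * n * κ * LocalGcd.projHeight F + 30 * n * κ * Real.log ((n : ℝ) * (m : ℝ))
        + 15 * e * n := by
  have hy0 : y ≠ 0 := by
    rintro rfl
    simp at hκ
  have hκ1 : 1 ≤ κ := by
    by_contra h
    have h0 : κ = 0 := by omega
    subst h0
    have := (PowerSeries.order_eq_nat.1 hκ).1
    rw [PowerSeries.coeff_zero_eq_constantCoeff_apply] at this
    exact this hy
  have h0 := LocalGcd.yCoeff_zero_ne_zero hF hy0 hFy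
  have heq := hFy
  rw [LocalGcd.aeval_eq_sum_yCoeff, ← hn] at heq
  have hn1 : 1 ≤ n := by
    obtain ⟨J, hJ, hJne, -, hJs⟩ := LocalGcd.exists_edge_sum_eq_zero (LocalGcd.yCoeff F) n e κ he y hκ
      heq ⟨0, Nat.zero_le n, h0⟩
    exact LocalGcd.one_le_degree_of_edge h0 hJ hJne hJs
  -- If m = 0, then f_0 is constant, and setting t = 0 in the equation, where y vanishes, gives f_0
  -- = 0. The bound m ≥ 1 is what makes log(nm) at least log n.
  have hm1 : 1 ≤ m := by
    by_contra h
    have hm0 : F.degreeOf 0 = 0 := by omega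
    have h1 : LocalGcd.yCoeff F 0 = Polynomial.C ((LocalGcd.yCoeff F 0).coeff 0) := by
      rw [LocalGcd.coeff_yCoeff, LocalGcd.yCoeff, hm0]
      simp
    have h2 := congrArg PowerSeries.constantCoeff heq
    rw [Finset.sum_range_succ', map_add, map_sum, Finset.sum_eq_zero, h1] at h2
    · apply h0
      rw [h1]
      simpa using h2
    · intro j _
      rw [map_mul, map_pow, hy, pow_succ, mul_zero, mul_zero]
  have hn' : (1 : ℝ) ≤ n := by exact_mod_cast hn1
  have hm' : (1 : ℝ) ≤ m := by exact_mod_cast hm1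
  have hκ' : (1 : ℝ) ≤ κ := by exact_mod_cast hκ1
  have he' : (1 : ℝ) ≤ e := by exact_mod_cast he
  have hlogn : 0 ≤ Real.log n := Real.log_nonneg hn'
  have hlog : Real.log n ≤ Real.log ((n : ℝ) * m) :=
    Real.log_le_log (by linarith) (le_mul_of_one_le_right (by linarith) hm')
  have hh : 0 ≤ LocalGcd.projHeight F :=
    div_nonneg (Height.logHeight_nonneg _) (Nat.cast_nonneg _)
  have hnκ : (n : ℝ) ≤ n * κ := le_mul_of_one_le_right (by linarith) hκ'
  have hbound : ((n : ℝ) + 1) * LocalGcd.projHeight F + (10 * n + 6 * n * Real.log n) ≤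
      30 * n * κ * LocalGcd.projHeight F + 30 * n * κ * Real.log ((n : ℝ) * (m : ℝ))
        + 15 * e * n := by
    have h1 : ((n : ℝ) + 1) * LocalGcd.projHeight F ≤ 30 * n * κ * LocalGcd.projHeight F := by
      gcongr
      linarith
    have h2 : 6 * n * Real.log n ≤ 30 * n * κ * Real.log ((n : ℝ) * (m : ℝ)) := by
      have := mul_le_mul hnκ hlog hlogn (by positivity)
      have := mul_nonneg (show (0 : ℝ) ≤ n by positivity) hlogn
      linarith
    have h3 : 10 * (n : ℝ) ≤ 15 * e * n := by nlinarith
    linarith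
  subst hT hξ
  -- If α = 0, then β ≠ 0 and T is empty. Otherwise T is finite because |α|_v ≠ 1 at only finitely
  -- many finite places.
  rcases eq_or_ne ξ 0 with rfl | hξ0
  · have hβ : β ≠ 0 := hαβ.resolve_left (by simp [he.ne'])
    rw [LocalGcd.convSet_zero_eq_empty hy hβ]
    refine ⟨Set.finite_empty, le_trans ?_ hbound⟩
    simp only [LocalGcd.lgcdOn, LocalGcd.heightOn, finsum_mem_empty, mul_zero, sub_zero, abs_zero]
    positivity
  · have hfin : (LocalGcd.convSet y (ξ ^ e) ξ β).Finite :=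
      (LocalGcd.finite_setOf_normAbs_lt_one (pow_ne_zero e hξ0)).subset fun v hv => hv.1
    exact ⟨hfin, (LocalGcd.abs_lgcdOn_sub_le hn hξ0 he hFy hκ h0 hfin).trans hbound⟩
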